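/- **Setting.** Let $m\ge 2$, $t_0\ge 0$, and consider $n$ manipulators $i\in\mathcal V=\{1,\dots,n\}$ with $p_i\ge m$ degrees of freedom, $$H_i(q_i)\ddot q_i+C_i(q_i,\dot q_i)\dot q_i+g_i(q_i)+d_i(t)=u_i,\qquad x_i=\psi_i(q_i),\quad \dot x_i=J_i(q_i)\dot q_i,\quad J_i=\partial\psi_i/\partial q_i,\qquad t\ge t_0,$$ where $q_i,u_i\in\mathbb R^{p_i}$ and $x_i\in\mathbb R^m$; $\mathcal F=\{i: p_i>m\}$ is the set of redundant manipulators. Let $\Theta_i\subseteq\mathbb R^{p_i}$ be the set of possible joint configurations, and let $H_i$ be $C^1$, $\psi_i$ be $C^2$, and $C_i$, $g_i$ and the regressor $Y_i$ below be continuous. Assume, for $q\in\Theta_i$ and uniformly in $q$: $H_i(q)$ is symmetric, uniformly positive definite and bounded; $\dot H_i-2C_i$ is skew symmetric; $g_i(q)$ is bounded, $\|C_i(q,\dot q)\|\le \bar c_i\|\dot q\|$, and $d_i$ is bounded on $[t_0,\infty)$; $H_i(q)x+C_i(q,\dot q)y+g_i(q)=Y_i(q,\dot q,y,x)\vartheta_i$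 for all vectors $x,y,\dot q$, with a constant parameter vector $\vartheta_i\in\mathbb R^{r_i}$ and a regressor $Y_i$ that is bounded for bounded $\dot q,y,x$; $J_i(q)$ has rank $m$, and $J_i(q)$, its derivative in $q$, and $J_i^\sharp(q)$ are bounded. Here $J_i^\sharp=J_i^{-1}$ if $p_i=m$ and $J_i^\sharp=J_i^T(J_iJ_i^T)^{-1}$ if $p_i>m$. The leader $x_0,v_0,a_0:[t_0,\infty)\to\mathbb R^m$ satisfies $\dot x_0=v_0$, $\dot v_0=a_0$, with $a_0$ differentiable, and $\|v_0\|_\infty<\beta_1$, $\|a_0\|_\infty<\beta_2$, $\|\dot a_0\|_\infty<\beta_3$, where $\|\cdot\|_\infty$ is the supremum over all coordinates and all $t\ge t_0$ and $\beta_1,\beta_2,\beta_3>0$. At each time $t\ge t_0$ the manipulators interact through a digraph $\mathcal G(t)$ with weights $\varepsilon_{ij}(t)\ge0$, $\varepsilon_{ii}(t)=0$ (node $i$ receives the state of $j$ iff $j\in\mathcal N_i(t)$, i.e. $\varepsilon_{ij}(t)>0$), and through pinning weights $\mathcal B(t)=(b_i(t))_i$, $b_i(t)\ge0$ (node $i$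 receives the state of the leader iff $b_i(t)>0$). **Algorithm.** With $\alpha_i>0$ and a $C^1$ subtask vector $\varphi_i=\varphi_i(t,q_i)\in\mathbb R^{p_i}$ that is bounded together with its first derivatives on $[t_0,\infty)\times\Theta_i$, put $$\dot{\hat q}_{ri}=J_i^\sharp(\hat v_i-\alpha_i(x_i-\hat x_i))+(I-J_i^\sharp J_i)\varphi_i,$$ $$\ddot{\hat q}_{ri}=\dot J_i^\sharp(\hat v_i-\alpha_i(x_i-\hat x_i))+J_i^\sharp(\hat a_i-\alpha_i(\dot x_i-\hat v_i))+\tfrac{d}{dt}\big[(I-J_i^\sharp J_i)\varphi_i\big],\qquad \hat s_i=\dot q_i-\dot{\hat q}_{ri},$$ and, writing $Y_i$ for $Y_i(q_i,\dot q_i,\dot{\hat q}_{ri},\ddot{\hat q}_{ri})$ and $\mathrm{sgn}$ for the componentwise signum, use the control and adaptation laws $$u_i=Y_i\hat\vartheta_i-J_i^T\mathcal K_{xi}J_i\hat s_i-\mathcal K_{si}\hat s_i-\mathcal K_{ri}\,\mathrm{sgn}(\hat s_i),\qquad \dot{\hat\vartheta}_i=-\mathcal T_iY_i^T\hat s_i,$$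 and, for $\zeta_i=\mathrm{col}(\hat x_i,\hat v_i,\hat a_i)$, $\sigma_{ij}=\zeta_i-\zeta_j$, $\sigma_i=\zeta_i-\mathrm{col}(x_0,v_0,a_0)$, the estimators $$\dot\zeta_i=-\big(\mathrm{diag}(\beta_1,\beta_2,\beta_3)\otimes I_m\big)\,\mathrm{sgn}\Big(\sum_{j\in\mathcal N_i(t)}\varepsilon_{ij}(t)\sigma_{ij}+b_i(t)\sigma_i\Big).$$ Here $\mathcal K_{xi},\mathcal K_{si},\mathcal K_{ri},\mathcal T_i$ are symmetric positive definite (i.e. have positive minimum eigenvalue), $\mathcal K_{ri}$ and $\mathcal T_i$ are diagonal, and $\lambda_{\min}(\mathcal K_{ri})\ge\sup_{t\ge t_0}\|d_i(t)\|$. Solutions of the closed loop are understood in the sense of Filippov. **Claim.** Suppose that at every time $t\ge t_0$ the leader has a directed path to every manipulator under $\mathcal G(t)$ and $\mathcal B(t)$. Then along every Filippov solution of the closed loop on $[t_0,\infty)$ with $q_i(t)\in\Theta_i$ for all $t\ge t_0$ and all $i$, as $t\to\infty$, $$x_i-x_0\to0\quad\text{and}\quad \dot x_i-v_0\to0\quad\text{for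 all } i\in\mathcal V,\qquad e_{si}=(I-J_i^\sharp J_i)(\dot q_i-\varphi_i)\to0\quad\text{for all } i\in\mathcal F.$$ -/

import Mathlib

open MeasureTheory Filter Topology

noncomputable section

/-- `ℝ^k` with the Euclidean norm. -/
abbrev Vec (k : ℕ) : Type := EuclideanSpace ℝ (Fin k)

/-! ### Generalities: Filippov solutions, signum, minimum eigenvalue -/

/-- Filippov's set-valued map of a (discontinuous) vector field `f` at `x`: the intersection, over
all `δ > 0` and all Lebesgue null sets `N`, of the closed convex hulls of `f (B(x, δ) \ N)`. -/
def filippov {E : Type*} [NormedAddCommGroup E] [NormedSpace ℝ E] [MeasureSpace E]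
    (f : E → E) (x : E) : Set E :=
  ⋂ (δ : ℝ) (_ : 0 < δ) (N : Set E) (_ : volume N = 0),
    closure (convexHull ℝ (f '' (Metric.ball x δ \ N)))

/-- `z` is a Filippov solution of `ż = f(t, z)` on `[t₀, ∞)`: it is locally absolutely continuous
there and `ż(t)` exists and lies in Filippov's set for almost every `t ≥ t₀`. -/
def IsFilippovSolution {E : Type*} [NormedAddCommGroup E] [NormedSpace ℝ E] [MeasureSpace E]
    (f : ℝ → E → E) (t₀ : ℝ) (z : ℝ → E) : Prop :=
  (∀ T, t₀ ≤ T → AbsolutelyContinuousOnInterval z t₀ T) ∧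
    ∀ᵐ t : ℝ, t₀ < t → ∃ w ∈ filippov (f t) (z t), HasDerivAt z w t

/-- The componentwise signum of a vector. -/
def sgn {k : ℕ} (v : Vec k) : Vec k := WithLp.toLp 2 fun j => Real.sign (v j)

/-- The action of a real matrix on `ℝ^k`. -/
def act {k : ℕ} (A : Matrix (Fin k) (Fin k) ℝ) (v : Vec k) : Vec k :=
  Matrix.toEuclideanCLM (𝕜 := ℝ) A v

/-- The minimum eigenvalue of a real symmetric matrix. -/
def lambdaMin {k : ℕ} (A : Matrix (Fin k) (Fin k) ℝ) : ℝ := sInf (spectrum ℝ A)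

/-! ### Manipulators -/

/-- The data of a manipulator with `p` degrees of freedom, an `m`-dimensional task space and `r`
dynamic parameters. -/
structure Manipulator (m p r : ℕ) where
  /-- inertia matrix `H(q)` -/
  H : Vec p → (Vec p →L[ℝ] Vec p)
  /-- centripetal-Coriolis matrix `C(q, q̇)` -/
  C : Vec p → Vec p → (Vec p →L[ℝ] Vec p)
  /-- gravity vector `g(q)` -/
  g : Vec p → Vec p
  /-- input disturbance `d(t)` -/
  d : ℝ → Vec p
  /-- forward kinematics `ψ(q)` -/
  ψ : Vec p → Vec m
  /-- regressor `Y(q, q̇, y, x)` -/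
  Y : Vec p → Vec p → Vec p → Vec p → (Vec r →L[ℝ] Vec p)
  /-- constant dynamic parameters `ϑ` -/
  ϑ : Vec r
  /-- the set of possible joint configurations -/
  Θ : Set (Vec p)

namespace Manipulator

variable {m p r : ℕ} (M : Manipulator m p r)

/-- The Jacobian `J(q) = ∂ψ/∂q`. -/
def J (q : Vec p) : Vec p →L[ℝ] Vec m := fderiv ℝ M.ψ q

/-- `J^♯`: the inverse `J⁻¹` of a nonredundant manipulator (`p = m`), and the pseudoinverse
`Jᵀ (J Jᵀ)⁻¹` of a redundant one. -/
def Jsharp (q : Vec p) : Vec m →L[ℝ] Vec p :=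
  if p = m then (M.J q).inverse
  else (M.J q).adjoint ∘L (M.J q ∘L (M.J q).adjoint).inverse

/-- `I - J^♯ J`. -/
def nullProj (q : Vec p) : Vec p →L[ℝ] Vec p :=
  ContinuousLinearMap.id ℝ (Vec p) - M.Jsharp q ∘L M.J q

/-- The standing properties of a manipulator: regularity of the data, (P1), (P2), (P3), and
bounded kinematics without singularities. All bounds are uniform over the possible joint
configurations. -/
structure Standing (t₀ : ℝ) : Prop where
  smooth_H : ContDiff ℝ 1 M.H
  continuous_C : Continuous fun z : Vec p × Vec p => M.C z.1 z.2
  continuous_g : Continuous M.g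
  smooth_ψ : ContDiff ℝ 2 M.ψ
  continuous_Y : Continuous fun z : Vec p × Vec p × Vec p × Vec p => M.Y z.1 z.2.1 z.2.2.1 z.2.2.2
  /-- (P1) `H(q)` is symmetric, uniformly positive definite -/
  selfAdjoint_H : ∀ q ∈ M.Θ, IsSelfAdjoint (M.H q)
  posDef_H : ∃ h > 0, ∀ q ∈ M.Θ, ∀ v : Vec p, h * ‖v‖ ^ 2 ≤ inner ℝ v (M.H q v)
  /-- (P1) `Ḣ(q) - 2 C(q, q̇)` is skew symmetric, where `Ḣ = DH(q)[q̇]` -/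
  skew : ∀ q ∈ M.Θ, ∀ v w : Vec p, inner ℝ w ((fderiv ℝ M.H q v - (2 : ℝ) • M.C q v) w) = 0
  /-- (P2) boundedness of the dynamic terms -/
  bounded_H : ∃ c, ∀ q ∈ M.Θ, ‖M.H q‖ ≤ c
  bounded_g : ∃ c, ∀ q ∈ M.Θ, ‖M.g q‖ ≤ c
  bounded_d : ∃ c, ∀ t, t₀ ≤ t → ‖M.d t‖ ≤ c
  bounded_C : ∃ c > 0, ∀ q ∈ M.Θ, ∀ v : Vec p, ‖M.C q v‖ ≤ c * ‖v‖
  /-- (P3) linear parametrization, with a regressor that is bounded when the vectors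
  `q̇, y, x` are -/
  regressor : ∀ q ∈ M.Θ, ∀ v y x : Vec p, M.H q x + M.C q v y + M.g q = M.Y q v y x M.ϑ
  bounded_Y : ∀ R : ℝ, ∃ c, ∀ q ∈ M.Θ, ∀ v y x : Vec p,
    ‖v‖ ≤ R → ‖y‖ ≤ R → ‖x‖ ≤ R → ‖M.Y q v y x‖ ≤ c
  /-- no kinematic singularities, bounded kinematic terms, and bounded `J̇` for bounded `q̇` -/
  full_rank : ∀ q ∈ M.Θ, Module.finrank ℝ (LinearMap.range (M.J q).toLinearMap) = m
  bounded_J : ∃ c, ∀ q ∈ M.Θ, ‖M.J q‖ ≤ c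
  bounded_Jsharp : ∃ c, ∀ q ∈ M.Θ, ‖M.Jsharp q‖ ≤ c
  bounded_dJ : ∃ c, ∀ q ∈ M.Θ, ‖fderiv ℝ M.J q‖ ≤ c

end Manipulator

/-! ### Local controllers -/

/-- Control parameters of one manipulator, and its subtask vector `φ(t, q)`. -/
structure Controller (m p r : ℕ) where
  α : ℝ
  Kx : Matrix (Fin m) (Fin m) ℝ
  Ks : Matrix (Fin p) (Fin p) ℝ
  Kr : Matrix (Fin p) (Fin p) ℝ
  T : Matrix (Fin r) (Fin r) ℝ
  φ : ℝ → Vec p → Vec p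

/-- Conditions on the control parameters (positive definiteness of a symmetric matrix is
`λ_min > 0`), and boundedness of the subtask vector and its derivative over the set `Θ` of possible
joint configurations. -/
structure Controller.Admissible {m p r : ℕ} (K : Controller m p r) (M : Manipulator m p r)
    (t₀ : ℝ) : Prop where
  α_pos : 0 < K.α
  Kx_posDef : K.Kx.PosDef
  Ks_posDef : K.Ks.PosDef
  Kr_posDef : K.Kr.PosDef
  Kr_diag : K.Kr.IsDiag
  T_posDef : K.T.PosDef
  T_diag : K.T.IsDiag
  Kr_dominates : ⨆ t : Set.Ici t₀, ‖M.d t‖ ≤ lambdaMin K.Kr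
  smooth_φ : ContDiff ℝ 1 fun y : ℝ × Vec p => K.φ y.1 y.2
  bounded_φ : ∃ c, ∀ t, t₀ ≤ t → ∀ q ∈ M.Θ, ‖K.φ t q‖ ≤ c
  bounded_dφ : ∃ c, ∀ t, t₀ ≤ t → ∀ q ∈ M.Θ,
    ‖fderiv ℝ (fun y : ℝ × Vec p => K.φ y.1 y.2) (t, q)‖ ≤ c

/-- The state of one manipulator with its estimators. -/
abbrev NodeState (m p r : ℕ) : Type := Vec p × Vec p × Vec r × Vec m × Vec m × Vec m

/-- Lebesgue measure on the state space (the product of the Lebesgue measures of the factors). -/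
instance NodeState.measureSpace (m p r : ℕ) : MeasureSpace (NodeState m p r) := inferInstance

namespace NodeState

variable {m p r : ℕ} (z : NodeState m p r)

/-- joint position `q` -/
abbrev q : Vec p := z.1
/-- joint velocity `q̇` -/
abbrev dq : Vec p := z.2.1
/-- parameter estimate `ϑ̂` -/
abbrev est : Vec r := z.2.2.1
/-- estimate `x̂` of the leader's position -/
abbrev xh : Vec m := z.2.2.2.1
/-- estimate `v̂` of the leader's velocity -/
abbrev vh : Vec m := z.2.2.2.2.1
/-- estimate `â` of the leader's acceleration -/
abbrev ah : Vec m := z.2.2.2.2.2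

end NodeState

section Control

variable {m p r : ℕ} (M : Manipulator m p r) (K : Controller m p r)

/-- Joint-space auxiliary velocity
`J^♯ (v̂ - α (x - x̂)) + (I - J^♯ J) φ`. -/
def auxVel (t : ℝ) (z : NodeState m p r) : Vec p :=
  M.Jsharp z.q (z.vh - K.α • (M.ψ z.q - z.xh)) + M.nullProj z.q (K.φ t z.q)

/-- Joint-space auxiliary acceleration
`(dJ^♯/dt) (v̂ - α (x - x̂)) + J^♯ (â - α (ẋ - v̂)) + d/dt [(I - J^♯ J) φ]`,
where `d/dt` is the derivative along a motion with joint velocity `q̇`. -/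
def auxAcc (t : ℝ) (z : NodeState m p r) : Vec p :=
  (fderiv ℝ M.Jsharp z.q z.dq) (z.vh - K.α • (M.ψ z.q - z.xh))
    + M.Jsharp z.q (z.ah - K.α • (M.J z.q z.dq - z.vh))
    + fderiv ℝ (fun y : ℝ × Vec p => M.nullProj y.2 (K.φ y.1 y.2)) (t, z.q) (1, z.dq)

/-- `ŝ`: joint velocity minus auxiliary velocity. -/
def sHat (t : ℝ) (z : NodeState m p r) : Vec p := z.dq - auxVel M K t z

/-- The regressor in closed loop. -/
def regr (t : ℝ) (z : NodeState m p r) : Vec r →L[ℝ] Vec p :=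
  M.Y z.q z.dq (auxVel M K t z) (auxAcc M K t z)

/-- The control law `u = Y ϑ̂ - Jᵀ K_x J ŝ - K_s ŝ - K_r sgn ŝ`. -/
def torque (t : ℝ) (z : NodeState m p r) : Vec p :=
  regr M K t z z.est - (M.J z.q).adjoint (act K.Kx (M.J z.q (sHat M K t z)))
    - act K.Ks (sHat M K t z) - act K.Kr (sgn (sHat M K t z))

/-- The joint acceleration `H(q)⁻¹ (u - C(q, q̇) q̇ - g(q) - d(t))`. -/
def jointAcc (t : ℝ) (z : NodeState m p r) : Vec p :=
  (M.H z.q).inverse (torque M K t z - M.C z.q z.dq z.dq - M.g z.q - M.d t)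

/-- The adaptation law `dϑ̂/dt = - T Yᵀ ŝ`. -/
def adaptRate (t : ℝ) (z : NodeState m p r) : Vec r :=
  - act K.T ((regr M K t z).adjoint (sHat M K t z))

/-- The subtask error `e_s = (I - J^♯ J) (q̇ - φ)`. -/
def subtaskError (t : ℝ) (z : NodeState m p r) : Vec p :=
  M.nullProj z.q (z.dq - K.φ t z.q)

end Control

/-! ### Leader and network -/

/-- Trajectory `x₀` of the leader, its velocity, acceleration and the derivative of the latter. -/
structure Leader (m : ℕ) where
  x : ℝ → Vec m
  v : ℝ → Vec m
  a : ℝ → Vec m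
  da : ℝ → Vec m

/-- `ẋ₀ = v₀`, `v̇₀ = a₀` on `[t₀, ∞)`, and (A2): `‖v₀‖_∞ < β₁`, `‖a₀‖_∞ < β₂`, `‖ȧ₀‖_∞ < β₃`, where
`‖·‖_∞` is the supremum over all coordinates and all times. -/
structure Leader.Bounded {m : ℕ} (L : Leader m) (β₁ β₂ β₃ t₀ : ℝ) : Prop where
  deriv_x : ∀ t, t₀ ≤ t → HasDerivWithinAt L.x (L.v t) (Set.Ici t₀) t
  deriv_v : ∀ t, t₀ ≤ t → HasDerivWithinAt L.v (L.a t) (Set.Ici t₀) t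
  deriv_a : ∀ t, t₀ ≤ t → HasDerivWithinAt L.a (L.da t) (Set.Ici t₀) t
  bound_v : ∃ c < β₁, ∀ t, t₀ ≤ t → ∀ k, |L.v t k| ≤ c
  bound_a : ∃ c < β₂, ∀ t, t₀ ≤ t → ∀ k, |L.a t k| ≤ c
  bound_da : ∃ c < β₃, ∀ t, t₀ ≤ t → ∀ k, |L.da t k| ≤ c

/-- A weighted interaction: adjacency weights `ε i j` (node `i` uses the state of node `j` when
`ε i j > 0`) and pinning weights `b i`. -/
structure Interaction (n : ℕ) where
  ε : Matrix (Fin n) (Fin n) ℝ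
  b : Fin n → ℝ

namespace Interaction

variable {n : ℕ} (G : Interaction n)

/-- Nonnegative weights and no self-loops. -/
structure Valid : Prop where
  ε_nonneg : ∀ i j, 0 ≤ G.ε i j
  ε_diag : ∀ i, G.ε i i = 0
  b_nonneg : ∀ i, 0 ≤ G.b i

/-- `(j, i)` is an edge: node `i` can access the information of node `j`. -/
def Edge (j i : Fin n) : Prop := 0 < G.ε i j

/-- The leader has a directed path to every node, through a pinned node. -/
def LeaderReachable : Prop :=
  ∀ i, ∃ k, 0 < G.b k ∧ Relation.ReflTransGen G.Edge k i

open Classical in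
/-- The neighbour set of node `i`. -/
def nbrs (i : Fin n) : Finset (Fin n) := Finset.univ.filter fun j => G.Edge j i

/-- `∑_{j ∈ N_i} ε_ij (y_i - y_j) + b_i (y_i - y₀)`. -/
def disagreement {m : ℕ} (y : Fin n → Vec m) (y₀ : Vec m) (i : Fin n) : Vec m :=
  ∑ j ∈ G.nbrs i, G.ε i j • (y i - y j) + G.b i • (y i - y₀)

end Interaction

/-- The state of the whole network. -/
abbrev NetState {n : ℕ} (m : ℕ) (p r : Fin n → ℕ) : Type := (i : Fin n) → NodeState m (p i) (r i)

instance NetState.measureSpace {n : ℕ} (m : ℕ) (p r : Fin n → ℕ) :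
    MeasureSpace (NetState m p r) := MeasureSpace.pi

/-- The right-hand side of the closed loop formed by the manipulators, the control laws, the
adaptation laws, and the estimators over the time-varying interaction `G`. -/
def closedLoop {n m : ℕ} {p r : Fin n → ℕ}
    (M : (i : Fin n) → Manipulator m (p i) (r i)) (K : (i : Fin n) → Controller m (p i) (r i))
    (L : Leader m) (G : ℝ → Interaction n) (β₁ β₂ β₃ : ℝ)
    (t : ℝ) (z : NetState m p r) : NetState m p r := fun i =>
  ((z i).dq,
   jointAcc (M i) (K i) t (z i),
   adaptRate (M i) (K i) t (z i),
   -(β₁ • sgn ((G t).disagreement (fun j => (z j).xh) (L.x t) i)),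
   -(β₂ • sgn ((G t).disagreement (fun j => (z j).vh) (L.v t) i)),
   -(β₃ • sgn ((G t).disagreement (fun j => (z j).ah) (L.a t) i)))

end

/-! ### Absolutely continuous functions -/

section AbsolutelyContinuous

variable {E F : Type*} [NormedAddCommGroup E] [NormedSpace ℝ E]
  [NormedAddCommGroup F] [NormedSpace ℝ F]

/-! The loop is a cascade: estimators that do not see the manipulators, followed by decoupled
adaptive tracking.

Estimators. In each coordinate, let `P` be the largest positive part of the errors `ŷ_i - y₀`. Where
`P > 0`, a path from the leader forces some node of maximal error to have positive disagreement
(`LeaderReachable.exists_disagreement_pos`). There the signum is locally constant, Filippov's set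
fixes the derivative, and the error falls at a rate of at least `β - c`, where `c < β` bounds the
leader's rate. So `P` vanishes in finite time and stays zero; applied to the negated errors as well,
this gives exact agreement (`eventually_eq_of_signum_consensus`). The argument is pointwise in `t`,
so the graph may switch arbitrarily.

Tracking. Once the estimates are exact, `dx̂/dt = v̂` and `dv̂/dt = â`, so `auxAcc` is the true
derivative of `auxVel`. With `W = ½ ŝᵀHŝ` and the parameter energy `A`, skew symmetry and the
adaptation law give `(W + A)' ≤ -k‖ŝ‖²`. The switching does not spoil this: `K_r` is diagonal, so
the pairing of `H q̈` with `ŝ` is single-valued on Filippov's set (`continuousAt_inner_jointAcc`,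
`map_eq_of_mem_filippov`). All signals entering `W'` are bounded, hence `W → 0` by a Barbalat-type
argument (`tendsto_zero_of_dissipation`), and `ŝ → 0`.

Kinematics. `e = x - x̂` satisfies `ė = Jŝ - αe`, a stable linear system with vanishing input, so
`e` and `ẋ - v̂ = Jŝ - αe` tend to zero. The subtask error is `(I - J^♯J)ŝ`. -/

theorem LipschitzOnWith.comp_absolutelyContinuousOnInterval {X Y : Type*} [PseudoMetricSpace X]
    [PseudoMetricSpace Y] {f : X → Y} {c : ℝ → X} {a b : ℝ} {C : NNReal}
    (hf : LipschitzOnWith C f (c '' Set.uIcc a b)) (hc : AbsolutelyContinuousOnInterval c a b) :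
    AbsolutelyContinuousOnInterval (fun t => f (c t)) a b := by
  rw [absolutelyContinuousOnInterval_iff] at hc ⊢
  intro ε hε
  -- `C + 1` instead of `C`, since `C` may be zero.
  obtain ⟨δ, hδ, h⟩ := hc (ε / (C + 1)) (by positivity)
  refine ⟨δ, hδ, fun I hI hlt => ?_⟩
  have h1 := h I hI hlt
  calc _ ≤ ∑ i ∈ Finset.range I.1, C * dist (c (I.2 i).1) (c (I.2 i).2) := by
        refine Finset.sum_le_sum fun i hi => hf.dist_le_mul _ ?_ _ ?_
        · exact ⟨_, (hI.1 i hi).1, rfl⟩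
        · exact ⟨_, (hI.1 i hi).2, rfl⟩
    _ = C * ∑ i ∈ Finset.range I.1, dist (c (I.2 i).1) (c (I.2 i).2) := by
        rw [Finset.mul_sum]
    _ ≤ C * (ε / (C + 1)) := by gcongr
    _ < (C + 1) * (ε / (C + 1)) := by gcongr; linarith
    _ = ε := by field_simp

/-- The image of the curve is compact, so local Lipschitz bounds merge into one. Smoothness is asked
only along the curve because `J^♯` is known to be smooth only where `J` has full rank. -/
theorem ContDiffAt.comp_absolutelyContinuousOnInterval {f : E → F} {c : ℝ → E} {a b : ℝ}
    (hf : ∀ t ∈ Set.uIcc a b, ContDiffAt ℝ 1 f (c t)) (hc : AbsolutelyContinuousOnInterval c a b) :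
    AbsolutelyContinuousOnInterval (fun t => f (c t)) a b := by
  have hK : IsCompact (c '' Set.uIcc a b) := isCompact_uIcc.image_of_continuousOn hc.continuousOn
  have hloc : LocallyLipschitzOn (c '' Set.uIcc a b) f := by
    rintro _ ⟨t, ht, rfl⟩
    obtain ⟨C, s, hs, hL⟩ := (hf t ht).exists_lipschitzOnWith
    exact ⟨C, s, mem_nhdsWithin_of_mem_nhds hs, hL⟩
  obtain ⟨C, hC⟩ := hloc.exists_lipschitzOnWith_of_compact hK
  exact hC.comp_absolutelyContinuousOnInterval hc

theorem AbsolutelyContinuousOnInterval.prodMk {c : ℝ → E} {d : ℝ → F} {a b : ℝ}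
    (hc : AbsolutelyContinuousOnInterval c a b) (hd : AbsolutelyContinuousOnInterval d a b) :
    AbsolutelyContinuousOnInterval (fun t => (c t, d t)) a b := by
  have h1 := (ContinuousLinearMap.inl ℝ E F).lipschitz.lipschitzOnWith
    (s := c '' Set.uIcc a b) |>.comp_absolutelyContinuousOnInterval hc
  have h2 := (ContinuousLinearMap.inr ℝ E F).lipschitz.lipschitzOnWith
    (s := d '' Set.uIcc a b) |>.comp_absolutelyContinuousOnInterval hd
  simpa using h1.fun_add h2

theorem ContinuousLinearMap.comp_absolutelyContinuousOnInterval (ℓ : E →L[ℝ] F) {c : ℝ → E}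
    {a b : ℝ} (hc : AbsolutelyContinuousOnInterval c a b) :
    AbsolutelyContinuousOnInterval (fun t => ℓ (c t)) a b :=
  ℓ.lipschitz.lipschitzOnWith.comp_absolutelyContinuousOnInterval hc

theorem absolutelyContinuousOnInterval_id (a b : ℝ) :
    AbsolutelyContinuousOnInterval (fun t => t) a b :=
  (contDiff_id (𝕜 := ℝ) (n := 1)).contDiffOn.absolutelyContinuousOnInterval

/-! ### Differential inequalities that hold almost everywhere. -/

theorem AbsolutelyContinuousOnInterval.sub_le_of_ae_deriv_le {f : ℝ → ℝ} {a b c : ℝ} (hab : a ≤ b)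
    (hf : AbsolutelyContinuousOnInterval f a b)
    (h : ∀ᵐ t : ℝ, a < t → t < b → ∃ w ≤ c, HasDerivAt f w t) : f b - f a ≤ c * (b - a) := by
  rw [← hf.integral_deriv_eq_sub]
  have : c * (b - a) = ∫ _ in a..b, c := by simp [mul_comm]
  rw [this]
  refine intervalIntegral.integral_mono_ae_restrict hab hf.intervalIntegrable_deriv (by simp) ?_
  rw [EventuallyLE, ae_restrict_iff' measurableSet_Icc]
  have ha : ∀ᵐ t : ℝ, t ≠ a := by simp [ae_iff, measure_singleton]
  have hb : ∀ᵐ t : ℝ, t ≠ b := by simp [ae_iff, measure_singleton]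
  filter_upwards [h, ha, hb] with t h ha hb ht
  obtain ⟨w, hw, hd⟩ := h (lt_of_le_of_ne ht.1 ha.symm) (lt_of_le_of_ne ht.2 hb)
  rwa [hd.deriv]

theorem AbsolutelyContinuousOnInterval.le_add_mul_of_ae_deriv_le {f : ℝ → ℝ} {a c : ℝ}
    (hf : ∀ b, a ≤ b → AbsolutelyContinuousOnInterval f a b)
    (h : ∀ᵐ t : ℝ, a < t → ∃ w ≤ c, HasDerivAt f w t) {s t : ℝ} (has : a ≤ s) (hst : s ≤ t) :
    f t ≤ f s + c * (t - s) := by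
  have hf' : AbsolutelyContinuousOnInterval f s t := (hf t (has.trans hst)).mono <| by
    rw [Set.uIcc_of_le hst, Set.uIcc_of_le (has.trans hst)]
    exact Set.Icc_subset_Icc_left has
  have := hf'.sub_le_of_ae_deriv_le hst (c := c) <| by
    filter_upwards [h] with t h h1 _ using h (has.trans_lt h1)
  linarith

/-- Grönwall's inequality for `y' ≤ -α y + b`. -/
theorem AbsolutelyContinuousOnInterval.le_of_ae_deriv_le_neg_mul_add {y : ℝ → ℝ} {a α b : ℝ}
    (hα : 0 < α) (hy : ∀ t, a ≤ t → AbsolutelyContinuousOnInterval y a t)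
    (h : ∀ᵐ t : ℝ, a < t → ∃ w ≤ -α * y t + b, HasDerivAt y w t) {t : ℝ} (hat : a ≤ t) :
    y t ≤ Real.exp (-α * (t - a)) * (y a - b / α) + b / α := by
  have hexp : ∀ t, AbsolutelyContinuousOnInterval (fun t => Real.exp (α * (t - a))) a t :=
    fun t => ContDiffOn.absolutelyContinuousOnInterval (by fun_prop)
  have hconst : ∀ t, AbsolutelyContinuousOnInterval (fun _ => b / α) a t :=
    fun t => (contDiffOn_const (n := 1)).absolutelyContinuousOnInterval
  -- Integrating factor: `exp (α (t - a)) (y - b/α)` has nonpositive derivative.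
  have key := AbsolutelyContinuousOnInterval.le_add_mul_of_ae_deriv_le
    (f := fun t => Real.exp (α * (t - a)) * (y t - b / α)) (a := a) (c := 0)
    (fun t ht => (hexp t).fun_mul ((hy t ht).fun_sub (hconst t)))
    (by
      filter_upwards [h] with t h hat
      obtain ⟨w, hw, hd⟩ := h hat
      refine ⟨_, ?_, ((((hasDerivAt_id t).sub_const a).const_mul α).exp).mul (hd.sub_const _)⟩
      have he := Real.exp_pos (α * (t - a))
      have : α * (y t - b / α) + w ≤ 0 := by
        have : α * (b / α) = b := by field_simp
        linarith
      calc _ = Real.exp (α * (t - a)) * (α * (y t - b / α) + w) := by simp; ring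
        _ ≤ 0 := mul_nonpos_of_nonneg_of_nonpos he.le this) le_rfl hat
  simp only [sub_self, mul_zero, Real.exp_zero, one_mul, zero_mul, add_zero] at key
  have he := Real.exp_pos (-α * (t - a))
  have h2 := mul_le_mul_of_nonneg_left key he.le
  rw [← mul_assoc, ← Real.exp_add] at h2
  simp only [neg_mul, neg_add_cancel, Real.exp_zero, one_mul] at h2
  simp only [neg_mul]
  linarith

/-- If `V ≥ 0` decreases at a rate of at least `c W`, where `W ≥ 0` grows at a bounded rate,
then `W` tends to zero. -/
theorem tendsto_zero_of_dissipation {V W : ℝ → ℝ} {a c R : ℝ} (hc : 0 < c)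
    (hV : ∀ t, a ≤ t → AbsolutelyContinuousOnInterval V a t) (hV0 : ∀ t, a ≤ t → 0 ≤ V t)
    (hdV : ∀ᵐ t : ℝ, a < t → ∃ w ≤ -c * W t, HasDerivAt V w t)
    (hW : ∀ t, a ≤ t → AbsolutelyContinuousOnInterval W a t) (hW0 : ∀ t, a ≤ t → 0 ≤ W t)
    (hdW : ∀ᵐ t : ℝ, a < t → ∃ w, |w| ≤ R ∧ HasDerivAt W w t) :
    Tendsto W atTop (𝓝 0) := by
  -- A positive rate bound, so that it can be divided by.
  set R' := max R 1 with hR'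
  have hRpos : 0 < R' := lt_max_of_lt_right one_pos
  have hanti : AntitoneOn V (Set.Ici a) := by
    intro s hs t _ hst
    have := AbsolutelyContinuousOnInterval.le_add_mul_of_ae_deriv_le (c := 0) hV (by
      filter_upwards [hdV] with t h hat
      obtain ⟨w, hw, hd⟩ := h hat
      exact ⟨w, hw.trans (by nlinarith [hW0 t hat.le]), hd⟩) hs hst
    simpa using this
  have hWlow : ∀ s t, a ≤ s → s ≤ t → W s - R' * (t - s) ≤ W t := by
    intro s t hs hst
    have := AbsolutelyContinuousOnInterval.le_add_mul_of_ae_deriv_le (f := fun t => -W t) (c := R')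
      (fun t ht => (hW t ht).fun_neg) (by
      filter_upwards [hdW] with t h hat
      obtain ⟨w, hw, hd⟩ := h hat
      exact ⟨-w, (neg_le_abs w).trans (hw.trans (le_max_left _ _)), hd.neg⟩) hs hst
    linarith
  set I := sInf (V '' Set.Ici a)
  have hbdd : BddBelow (V '' Set.Ici a) := ⟨0, by rintro _ ⟨t, ht, rfl⟩; exact hV0 t ht⟩
  rw [Metric.tendsto_atTop]
  intro ε hε
  -- If `W t ≥ ε`, then `W ≥ ε/2` on `[t, t + δ]`, which costs `V` at least `c (ε/2) δ`. Past a time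
  -- `T` where `V` is within that amount of its infimum, this is impossible.
  set δ := ε / (2 * R')
  have hδ : 0 < δ := by positivity
  have hη : 0 < c * (ε / 2) * δ := by positivity
  obtain ⟨_, ⟨T, hT, rfl⟩, hTI⟩ := exists_lt_of_csInf_lt (⟨V a, a, Set.mem_Ici.2 le_rfl, rfl⟩ :
    (V '' Set.Ici a).Nonempty) (lt_add_of_pos_right I hη)
  refine ⟨T, fun t ht => ?_⟩
  have hat : a ≤ t := le_trans hT ht
  rw [Real.dist_eq, sub_zero, abs_of_nonneg (hW0 t hat)]
  by_contra! hcon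
  have hdec : V (t + δ) - V t ≤ -(c * (ε / 2)) * (t + δ - t) := by
    refine AbsolutelyContinuousOnInterval.sub_le_of_ae_deriv_le (by linarith)
      ((hV (t + δ) (by linarith)).mono ?_) ?_
    · rw [Set.uIcc_of_le (by linarith), Set.uIcc_of_le (by linarith)]
      exact Set.Icc_subset_Icc_left hat
    · filter_upwards [hdV] with s h hs1 hs2
      obtain ⟨w, hw, hd⟩ := h (by linarith)
      refine ⟨w, hw.trans ?_, hd⟩
      have h1 := hWlow t s hat hs1.le
      have h2 : R' * (s - t) ≤ R' * δ := by gcongr; linarith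
      have h3 : R' * δ = ε / 2 := by simp only [δ]; field_simp
      have : ε / 2 ≤ W s := by linarith
      nlinarith
  have h1 : V t ≤ V T := hanti hT hat ht
  have h2 : I ≤ V (t + δ) := csInf_le hbdd ⟨t + δ, by simp only [Set.mem_Ici]; linarith, rfl⟩
  have : t + δ - t = δ := by ring
  rw [this] at hdec
  linarith

end AbsolutelyContinuous

/-! ### Filippov sets -/

/-- A linear functional of the vector field that is continuous at a point is constant on
Filippov's set at that point. -/
theorem map_eq_of_mem_filippov {E F : Type*} [NormedAddCommGroup E] [NormedSpace ℝ E]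
    [MeasureSpace E] [NormedAddCommGroup F] [NormedSpace ℝ F] {f : E → E} {x w : E}
    (hw : w ∈ filippov f x) (ℓ : E →L[ℝ] F) (hf : ContinuousAt (fun y => ℓ (f y)) x) :
    ℓ w = ℓ (f x) := by
  refine eq_of_forall_dist_le fun ε hε => ?_
  obtain ⟨δ, hδ, h⟩ := Metric.continuousAt_iff.1 hf ε hε
  simp only [filippov, Set.mem_iInter] at hw
  -- Continuity controls the values on the whole ball, so no null set has to be removed.
  have h1 := hw δ hδ ∅ (by simp)
  have hsub : f '' (Metric.ball x δ \ ∅) ⊆ ℓ ⁻¹' Metric.closedBall (ℓ (f x)) ε := by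
    rintro _ ⟨y, hy, rfl⟩
    exact (h (by simpa using hy)).le
  have hconv : Convex ℝ (ℓ ⁻¹' Metric.closedBall (ℓ (f x)) ε) :=
    (convex_closedBall _ _).is_linear_preimage ℓ.toLinearMap.isLinear
  have hclosed : IsClosed (ℓ ⁻¹' Metric.closedBall (ℓ (f x)) ε) :=
    Metric.isClosed_closedBall.preimage ℓ.continuous
  exact closure_minimal (convexHull_min hsub hconv) hclosed h1

/-! ### Finite-time agreement of signum estimators -/

namespace Interaction

variable {n : ℕ} {G : Interaction n}

theorem mem_nbrs {i j : Fin n} : j ∈ G.nbrs i ↔ G.Edge j i := by simp [nbrs]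

/-- In a configuration with a positive maximal value, some node of maximal value has a positive
disagreement. -/
theorem LeaderReachable.exists_disagreement_pos (hG : G.Valid) (hreach : G.LeaderReachable)
    {e : Fin n → ℝ} {P : ℝ} (hP : 0 < P) (hle : ∀ i, e i ≤ P) {i₀ : Fin n} (hi₀ : e i₀ = P) :
    ∃ i, e i = P ∧ 0 < ∑ j ∈ G.nbrs i, G.ε i j * (e i - e j) + G.b i * e i := by
  by_contra! hcon
  have hsum : ∀ i, e i = P → ∀ j ∈ G.nbrs i, 0 ≤ G.ε i j * (e i - e j) := fun i hi j _ =>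
    mul_nonneg (hG.ε_nonneg i j) (by rw [hi]; linarith [hle j])
  have hb : ∀ i, e i = P → 0 ≤ G.b i * e i := fun i hi =>
    mul_nonneg (hG.b_nonneg i) (hi ▸ hP.le)
  obtain ⟨k, hk, hpath⟩ := hreach i₀
  -- Maximality spreads backwards along the path: at a maximal node all terms are nonnegative, so a
  -- nonpositive disagreement makes every in-neighbour maximal. At the pinned node the term `b k * P
  -- > 0` then contradicts this.
  have hkP : e k = P := by
    clear hk
    induction hpath using Relation.ReflTransGen.head_induction_on with
    | refl => exact hi₀
    | head hac _ ih =>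
      rename_i a c _
      have h1 := Finset.single_le_sum (hsum c ih) (mem_nbrs.2 hac)
      have h2 : 0 < G.ε c a := hac
      have h3 : G.ε c a * (e c - e a) ≤ 0 := by linarith [hcon c ih, hb c ih]
      have h4 : e c - e a ≤ 0 := by
        by_contra! h
        exact absurd (mul_pos h2 h) (not_lt.2 h3)
      linarith [hle a]
  have h1 := Finset.sum_nonneg (hsum k hkP)
  have h2 : 0 < G.b k * e k := mul_pos hk (by rw [hkP]; exact hP)
  linarith [hcon k hkP]

end Interaction

/-- Makes the largest positive part of an absolutely continuous vector absolutely continuous, hence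
differentiable almost everywhere. -/
theorem lipschitzWith_norm_posPart {ι : Type*} [Fintype ι] :
    LipschitzWith 1 fun v : ι → ℝ => ‖fun i => max (v i) 0‖ := by
  refine LipschitzWith.of_dist_le_mul fun v w => ?_
  rw [NNReal.coe_one, one_mul, dist_eq_norm v w]
  refine (abs_norm_sub_norm_le _ _).trans ((pi_norm_le_iff_of_nonneg (norm_nonneg _)).2 fun i => ?_)
  refine (abs_max_sub_max_le_abs (v i) (w i) 0).trans ?_
  simpa using norm_le_pi_norm (v - w) i

/-- The largest positive part `P` decreases at rate at least `κ` while it is positive: its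
derivative equals that of any component attaining it, and one of these has positive disagreement. It
reaches zero by time `t₀ + P t₀ / κ`. -/
theorem eventually_nonpos_of_disagreement {n : ℕ} {G : ℝ → Interaction n} {t₀ κ : ℝ} (hκ : 0 < κ)
    (hG : ∀ t, t₀ ≤ t → (G t).Valid) (hreach : ∀ t, t₀ ≤ t → (G t).LeaderReachable)
    {e : ℝ → Fin n → ℝ} (he : ∀ t, t₀ ≤ t → AbsolutelyContinuousOnInterval e t₀ t)
    (hd : ∀ᵐ t : ℝ, t₀ < t → ∀ i, ∃ w, HasDerivAt (fun t => e t i) w t ∧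
      (0 < ∑ j ∈ (G t).nbrs i, (G t).ε i j * (e t i - e t j) + (G t).b i * e t i → w ≤ -κ)) :
    ∀ᶠ t in atTop, ∀ i, e t i ≤ 0 := by
  set P : ℝ → ℝ := fun t => ‖fun i => max (e t i) 0‖ with hPdef
  have hPAC : ∀ t, t₀ ≤ t → AbsolutelyContinuousOnInterval P t₀ t := fun t ht =>
    LipschitzOnWith.comp_absolutelyContinuousOnInterval (c := e)
      (f := fun v : Fin n → ℝ => ‖fun i => max (v i) 0‖)
      lipschitzWith_norm_posPart.lipschitzOnWith (he t ht)
  have hP0 : ∀ t, 0 ≤ P t := fun t => norm_nonneg _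
  have heP : ∀ t i, e t i ≤ P t := fun t i => (le_max_left _ _).trans <|
    (le_abs_self _).trans (norm_le_pi_norm (fun i => max (e t i) 0) i)
  have hPe : ∀ t, 0 < P t → ∃ i, e t i = P t := by
    intro t ht
    by_contra! hcon
    have hlt : ∀ i, ‖max (e t i) 0‖ < P t := fun i => by
      rw [Real.norm_of_nonneg (le_max_right _ _)]
      exact max_lt (lt_of_le_of_ne (heP t i) (hcon i)) ht
    exact lt_irrefl _ ((pi_norm_lt_iff ht).2 hlt)
  have hdiff : ∀ᵐ t : ℝ, t₀ < t → DifferentiableAt ℝ P t := by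
    have : ∀ᵐ t : ℝ, ∀ N : ℕ, t ∈ Set.uIcc t₀ (t₀ + N) → DifferentiableAt ℝ P t :=
      ae_all_iff.2 fun N => (hPAC (t₀ + N) (by simp)).ae_differentiableAt
    filter_upwards [this] with t h ht
    obtain ⟨N, hN⟩ := exists_nat_ge (t - t₀)
    refine h N ?_
    rw [Set.uIcc_of_le (by simp)]
    exact ⟨ht.le, by linarith⟩
  have hdP : ∀ᵐ t : ℝ, t₀ < t → ∃ w, HasDerivAt P w t ∧ w ≤ 0 ∧ (0 < P t → w ≤ -κ) := by
    filter_upwards [hd, hdiff] with t hd hdiff ht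
    have hD := (hdiff ht).hasDerivAt
    by_cases hpos : 0 < P t
    · obtain ⟨i₀, hi₀⟩ := hPe t hpos
      obtain ⟨i, hi, hdis⟩ :=
        (hreach t ht.le).exists_disagreement_pos (hG t ht.le) hpos (heP t) hi₀
      obtain ⟨w, hw, hwκ⟩ := hd ht i
      -- `P` lies above the component `i` and touches it at `t`, so the two derivatives agree there.
      have hmin : IsLocalMin (fun s => P s - e s i) t := by
        refine Eventually.of_forall fun s => ?_
        change P t - e t i ≤ P s - e s i
        linarith [heP s i]
      have h0 := hmin.hasDerivAt_eq_zero (hD.sub hw)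
      have := hwκ hdis
      exact ⟨_, hD, by linarith, fun _ => by linarith⟩
    · have hPt : P t = 0 := le_antisymm (not_lt.1 hpos) (hP0 t)
      have hmin : IsLocalMin P t := Eventually.of_forall fun s => by rw [hPt]; exact hP0 s
      have h0 := hmin.hasDerivAt_eq_zero hD
      exact ⟨_, hD, h0.le, fun h => absurd h hpos⟩
  have hanti : ∀ s t, t₀ ≤ s → s ≤ t → P t ≤ P s := fun s t hs hst => by
    have := AbsolutelyContinuousOnInterval.le_add_mul_of_ae_deriv_le (c := 0) hPAC (by
      filter_upwards [hdP] with t h ht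
      obtain ⟨w, h1, h2, _⟩ := h ht
      exact ⟨w, h2, h1⟩) hs hst
    simpa using this
  -- The extra unit of time makes the contradiction strict: if `P` were still positive then, it
  -- would have dropped by at least `P t₀ + κ`.
  filter_upwards [eventually_ge_atTop (t₀ + (P t₀ / κ + 1))] with t ht i
  have hle : t₀ ≤ t₀ + (P t₀ / κ + 1) := by have := hP0 t₀; have : 0 ≤ P t₀ / κ := by positivity
                                            linarith
  refine (heP t i).trans ((hanti _ _ hle ht).trans ?_)
  by_contra! hcon
  have := (hPAC _ hle).sub_le_of_ae_deriv_le hle (c := -κ) (by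
    filter_upwards [hdP] with s h h1 h2
    obtain ⟨w, hw1, _, hw2⟩ := h h1
    exact ⟨w, hw2 (hcon.trans_le (hanti _ _ h1.le h2.le)), hw1⟩)
  have h3 : -κ * (t₀ + (P t₀ / κ + 1) - t₀) = -P t₀ - κ := by field_simp; ring
  linarith

theorem Interaction.disagreement_apply {n m : ℕ} (G : Interaction n) (y : Fin n → Vec m)
    (y₀ : Vec m) (i : Fin n) (k : Fin m) :
    G.disagreement y y₀ i k =
      ∑ j ∈ G.nbrs i, G.ε i j * ((y i k - y₀ k) - (y j k - y₀ k)) + G.b i * (y i k - y₀ k) := by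
  simp [Interaction.disagreement]

/-- The estimators reach the leader's signal in finite time. -/
theorem eventually_eq_of_signum_consensus {n m : ℕ} {G : ℝ → Interaction n} {t₀ β : ℝ}
    (hG : ∀ t, t₀ ≤ t → (G t).Valid) (hreach : ∀ t, t₀ ≤ t → (G t).LeaderReachable)
    {y : ℝ → Fin n → Vec m} (hy : ∀ t, t₀ ≤ t → AbsolutelyContinuousOnInterval y t₀ t)
    {y₀ dy₀ : ℝ → Vec m} (hy₀ : ∀ t, t₀ ≤ t → HasDerivWithinAt y₀ (dy₀ t) (Set.Ici t₀) t)
    (hbound : ∃ c < β, ∀ t, t₀ ≤ t → ∀ k, |dy₀ t k| ≤ c)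
    (hd : ∀ᵐ t : ℝ, t₀ < t → ∀ i, ∃ w, HasDerivAt (fun t => y t i) w t ∧
      ∀ k, (G t).disagreement (y t) (y₀ t) i k ≠ 0 →
        w k = -(β * Real.sign ((G t).disagreement (y t) (y₀ t) i k))) :
    ∀ᶠ t in atTop, ∀ i, y t i = y₀ t := by
  obtain ⟨c, hc, hbound⟩ := hbound
  have hcoord : ∀ k t, t₀ ≤ t → HasDerivWithinAt (fun t => y₀ t k) (dy₀ t k) (Set.Ici t₀) t :=
    fun k t ht => (EuclideanSpace.proj (𝕜 := ℝ) k : Vec m →L[ℝ] ℝ).hasFDerivAt.comp_hasDerivWithinAt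
      t (hy₀ t ht)
  have hAC : ∀ k t, t₀ ≤ t →
      AbsolutelyContinuousOnInterval (fun t i => y t i k - y₀ t k) t₀ t := by
    intro k t ht
    -- The leader's signal is absolutely continuous because its derivative is bounded.
    have hlip : LipschitzOnWith (Real.toNNReal c) (fun t => y₀ t k) (Set.Ici t₀) :=
      (convex_Ici t₀).lipschitzOnWith_of_nnnorm_hasDerivWithin_le (hcoord k) fun s hs => by
        rw [← NNReal.coe_le_coe, coe_nnnorm]
        exact (hbound s hs k).trans (Real.le_coe_toNNReal c)
    have h0 : AbsolutelyContinuousOnInterval (fun t => y₀ t k) t₀ t :=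
      (hlip.mono (by rw [Set.uIcc_of_le ht]; exact Set.Icc_subset_Ici_self)).absolutelyContinuousOnInterval
    have h1 := (ContinuousLinearMap.pi fun i => (EuclideanSpace.proj (𝕜 := ℝ) k : Vec m →L[ℝ] ℝ) ∘L
      ContinuousLinearMap.proj i).comp_absolutelyContinuousOnInterval (hy t ht)
    have h2 := (ContinuousLinearMap.pi fun _ : Fin n =>
      ContinuousLinearMap.id ℝ ℝ).comp_absolutelyContinuousOnInterval h0
    exact h1.fun_sub h2
  have hder : ∀ k, ∀ᵐ t : ℝ, t₀ < t → ∀ i, ∃ w, HasDerivAt (fun t => y t i k - y₀ t k) w t ∧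
      ((G t).disagreement (y t) (y₀ t) i k ≠ 0 →
        w = -(β * Real.sign ((G t).disagreement (y t) (y₀ t) i k)) - dy₀ t k) := by
    intro k
    filter_upwards [hd] with t hd ht i
    obtain ⟨w, hw, hwk⟩ := hd ht i
    refine ⟨w k - dy₀ t k, ?_, fun h => by rw [hwk k h]⟩
    exact ((EuclideanSpace.proj (𝕜 := ℝ) k : Vec m →L[ℝ] ℝ).hasFDerivAt.comp_hasDerivAt t hw).sub
      ((hcoord k t ht.le).hasDerivAt (Ici_mem_nhds ht))
  have hup : ∀ k, ∀ᶠ t in atTop, ∀ i, y t i k - y₀ t k ≤ 0 := by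
    intro k
    refine eventually_nonpos_of_disagreement (sub_pos.2 hc) hG hreach (hAC k) ?_
    filter_upwards [hder k] with t h ht i
    obtain ⟨w, hw, hwk⟩ := h ht i
    refine ⟨w, hw, fun hpos => ?_⟩
    rw [← Interaction.disagreement_apply] at hpos
    rw [hwk hpos.ne', Real.sign_of_pos hpos]
    linarith [neg_le_of_abs_le (hbound t ht.le k)]
  have hlow : ∀ k, ∀ᶠ t in atTop, ∀ i, -(y t i k - y₀ t k) ≤ 0 := by
    intro k
    refine eventually_nonpos_of_disagreement (e := fun t i => -(y t i k - y₀ t k))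
      (sub_pos.2 hc) hG hreach (fun t ht => (hAC k t ht).neg) ?_
    filter_upwards [hder k] with t h ht i
    obtain ⟨w, hw, hwk⟩ := h ht i
    refine ⟨-w, hw.neg, fun hpos => ?_⟩
    -- The disagreement is odd in the errors, so the negated errors obey the same estimate.
    have hneg : (G t).disagreement (y t) (y₀ t) i k < 0 := by
      rw [Interaction.disagreement_apply, ← neg_pos]
      convert hpos using 1
      rw [neg_add, ← Finset.sum_neg_distrib]
      congr 1
      · exact Finset.sum_congr rfl fun j _ => by ring
      · ring
    rw [hwk hneg.ne, Real.sign_of_neg hneg]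
    linarith [le_of_abs_le (hbound t ht.le k)]
  filter_upwards [eventually_all.2 hup, eventually_all.2 hlow] with t h1 h2 i
  ext k
  linarith [h1 k i, h2 k i]

/-! ### Moore–Penrose right inverses -/

section RightInverse

variable {E F : Type*} [NormedAddCommGroup E] [InnerProductSpace ℝ E] [FiniteDimensional ℝ E]
  [NormedAddCommGroup F] [InnerProductSpace ℝ F] [FiniteDimensional ℝ F]

theorem ContinuousLinearMap.IsInvertible.of_injective {T : E →L[ℝ] E}
    (hT : Function.Injective T) : T.IsInvertible :=
  ⟨(LinearEquiv.ofInjectiveEndo T.toLinearMap hT).toContinuousLinearEquiv, by ext; rfl⟩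

/-- `A A† x = 0` gives `‖A† x‖² = 0`, so `x` is orthogonal to the range of `A`, which is the whole
space. -/
theorem ContinuousLinearMap.IsInvertible.comp_adjoint_of_surjective {A : E →L[ℝ] F}
    (hA : Function.Surjective A) : (A ∘L A.adjoint).IsInvertible := by
  refine .of_injective ((injective_iff_map_eq_zero _).2 fun x hx => ?_)
  have h1 : A.adjoint x = 0 := by
    rw [← inner_self_eq_zero (𝕜 := ℝ), ContinuousLinearMap.adjoint_inner_left]
    change inner ℝ x ((A ∘L A.adjoint) x) = 0
    rw [hx, inner_zero_right]
  obtain ⟨y, rfl⟩ := hA x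
  rw [← inner_self_eq_zero (𝕜 := ℝ), ← ContinuousLinearMap.adjoint_inner_left, h1,
    inner_zero_left]

/-- The Moore–Penrose inverse `A† (A A†)⁻¹` of a surjective linear map. -/
noncomputable def rightInv (A : E →L[ℝ] F) : F →L[ℝ] E :=
  A.adjoint ∘L (A ∘L A.adjoint).inverse

theorem comp_rightInv {A : E →L[ℝ] F} (hA : Function.Surjective A) :
    A ∘L rightInv A = ContinuousLinearMap.id ℝ F := by
  rw [rightInv, ← ContinuousLinearMap.comp_assoc]
  exact (ContinuousLinearMap.IsInvertible.comp_adjoint_of_surjective hA).self_comp_inverse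

theorem contDiff_adjoint {n : WithTop ℕ∞} :
    ContDiff ℝ n fun A : E →L[ℝ] F => A.adjoint := by
  have : IsBoundedLinearMap ℝ fun A : E →L[ℝ] F => A.adjoint :=
    { map_add := fun A B => map_add _ A B
      map_smul := fun c A => by simp
      bound := ⟨1, one_pos, fun A => by simp⟩ }
  exact this.contDiff

theorem contDiffAt_rightInv {n : WithTop ℕ∞} {A : E →L[ℝ] F} (hA : Function.Surjective A) :
    ContDiffAt ℝ n rightInv A := by
  have h1 : ContDiffAt ℝ n (fun A : E →L[ℝ] F => A ∘L A.adjoint) A :=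
    (contDiff_id.clm_comp contDiff_adjoint).contDiffAt
  have h2 := ((ContinuousLinearMap.IsInvertible.comp_adjoint_of_surjective
    hA).contDiffAt_map_inverse (n := n)).comp A h1
  exact contDiff_adjoint.contDiffAt.clm_comp h2

/-- Unites the two cases of `Jsharp`. For singular `A` both sides are the default value `0` of
`inverse`, so the identity holds for every `A` and may be differentiated. -/
theorem rightInv_eq_inverse (hEF : Module.finrank ℝ E = Module.finrank ℝ F) (A : E →L[ℝ] F) :
    rightInv A = A.inverse := by
  by_cases hA : Function.Surjective A
  · have hinj : Function.Injective A :=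
      (LinearMap.injective_iff_surjective_of_finrank_eq_finrank hEF (f := A.toLinearMap)).2 hA
    have h := comp_rightInv hA
    refine (ContinuousLinearMap.inverse_eq h ?_).symm
    ext x
    exact hinj (by simpa using congrArg (fun B : F →L[ℝ] F => B (A x)) h)
  · rw [rightInv, ContinuousLinearMap.inverse_of_not_isInvertible
      (f := A) (fun h => hA h.surjective), ContinuousLinearMap.inverse_of_not_isInvertible
      (f := A ∘L A.adjoint) (fun h => hA (Function.Surjective.of_comp h.surjective)),
      ContinuousLinearMap.comp_zero]

/-- A bounded right inverse keeps `A` away from rank-deficient maps: the pairs `(A, B)` form a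
compact set on which `fderiv ℝ f` is continuous. This yields bounds uniform over `Θ`, which need not
be compact. -/
theorem exists_bound_fderiv_of_comp_eq_id {X : Type*} [NormedAddCommGroup X] [NormedSpace ℝ X]
    {f : (E →L[ℝ] F) → X} (hf : ∀ A : E →L[ℝ] F, Function.Surjective A → ContDiffAt ℝ 1 f A) (c c' : ℝ) :
    ∃ C, ∀ A : E →L[ℝ] F, ‖A‖ ≤ c → ∀ B : F →L[ℝ] E, ‖B‖ ≤ c' →
      A ∘L B = ContinuousLinearMap.id ℝ F → ‖fderiv ℝ f A‖ ≤ C := by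
  set S : Set ((E →L[ℝ] F) × (F →L[ℝ] E)) :=
    (Metric.closedBall 0 c ×ˢ Metric.closedBall 0 c') ∩
      {y | y.1 ∘L y.2 = ContinuousLinearMap.id ℝ F}
  have hS : IsCompact S := by
    refine ((isCompact_closedBall _ _).prod (isCompact_closedBall _ _)).inter_right ?_
    exact isClosed_eq (continuous_fst.clm_comp continuous_snd) continuous_const
  have hcont : ContinuousOn (fun y : (E →L[ℝ] F) × (F →L[ℝ] E) => fderiv ℝ f y.1) S := by
    intro y hy
    have hsurj : Function.Surjective y.1 := fun x =>
      ⟨y.2 x, by simpa using congrArg (fun B : F →L[ℝ] F => B x) hy.2⟩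
    exact (((hf y.1 hsurj).continuousAt_fderiv one_ne_zero).comp
      continuous_fst.continuousAt).continuousWithinAt
  obtain ⟨C, hC⟩ := hS.exists_bound_of_continuousOn (f := fun y => fderiv ℝ f y.1) hcont
  exact ⟨C, fun A hA B hB hAB => hC (A, B) ⟨⟨by simpa using hA, by simpa using hB⟩, hAB⟩⟩

end RightInverse

/-! ### Kinematics -/

namespace Manipulator

variable {m p r : ℕ} {M : Manipulator m p r} {t₀ : ℝ}

theorem Jsharp_eq_rightInv : M.Jsharp = fun q => rightInv (M.J q) := by
  funext q
  rw [Jsharp]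
  split_ifs with h
  · exact (rightInv_eq_inverse (by simp [h]) _).symm
  · rfl

namespace Standing

variable (hM : M.Standing t₀) {q : Vec p} (hq : q ∈ M.Θ)
include hM

theorem contDiff_J : ContDiff ℝ 1 M.J := hM.smooth_ψ.fderiv_right (by norm_num)

theorem hasFDerivAt_ψ (q : Vec p) : HasFDerivAt M.ψ (M.J q) q :=
  (hM.smooth_ψ.differentiable (by norm_num) q).hasFDerivAt

include hq

theorem surjective_J : Function.Surjective (M.J q) := by
  have : LinearMap.range (M.J q).toLinearMap = ⊤ :=
    Submodule.eq_top_of_finrank_eq (by simpa using hM.full_rank q hq)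
  exact LinearMap.range_eq_top.1 this

theorem J_Jsharp (v : Vec m) : M.J q (M.Jsharp q v) = v := by
  rw [Jsharp_eq_rightInv]
  simpa using congrArg (fun B : Vec m →L[ℝ] Vec m => B v) (comp_rightInv (hM.surjective_J hq))

theorem J_nullProj (v : Vec p) : M.J q (M.nullProj q v) = 0 := by
  simp [nullProj, hM.J_Jsharp hq]

theorem nullProj_Jsharp (v : Vec m) : M.nullProj q (M.Jsharp q v) = 0 := by
  simp [nullProj, hM.J_Jsharp hq]

theorem nullProj_nullProj (v : Vec p) : M.nullProj q (M.nullProj q v) = M.nullProj q v := by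
  change M.nullProj q v - M.Jsharp q (M.J q (M.nullProj q v)) = M.nullProj q v
  rw [hM.J_nullProj hq, map_zero, sub_zero]

theorem contDiffAt_Jsharp : ContDiffAt ℝ 1 M.Jsharp q := by
  rw [Jsharp_eq_rightInv]
  exact (contDiffAt_rightInv (hM.surjective_J hq)).comp q hM.contDiff_J.contDiffAt

theorem contDiffAt_nullProj : ContDiffAt ℝ 1 M.nullProj q :=
  contDiffAt_const.sub ((hM.contDiffAt_Jsharp hq).clm_comp hM.contDiff_J.contDiffAt)

omit hq

theorem bounded_comp_J {X : Type*} [NormedAddCommGroup X] [NormedSpace ℝ X]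
    {f : (Vec p →L[ℝ] Vec m) → X} (hf : ∀ A : Vec p →L[ℝ] Vec m, Function.Surjective A → ContDiffAt ℝ 1 f A) :
    ∃ c, 0 ≤ c ∧ ∀ q ∈ M.Θ, ‖fderiv ℝ (fun q => f (M.J q)) q‖ ≤ c := by
  obtain ⟨c, hc⟩ := hM.bounded_J
  obtain ⟨c', hc'⟩ := hM.bounded_Jsharp
  obtain ⟨d, hd⟩ := hM.bounded_dJ
  obtain ⟨C, hC⟩ := exists_bound_fderiv_of_comp_eq_id hf c c'
  refine ⟨|C| * |d|, by positivity, fun q hq => ?_⟩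
  have hf' := (hf _ (hM.surjective_J hq)).differentiableAt one_ne_zero
  have hJ' := (hM.contDiff_J.contDiffAt (x := q)).differentiableAt one_ne_zero
  rw [fderiv_fun_comp q hf' hJ']
  refine (ContinuousLinearMap.opNorm_comp_le _ _).trans ?_
  have h1 := (hC (M.J q) (hc q hq) (M.Jsharp q) (hc' q hq)
    (by ext1 v; exact hM.J_Jsharp hq v)).trans (le_abs_self C)
  have h2 := (hd q hq).trans (le_abs_self d)
  gcongr

theorem bounded_fderiv_Jsharp : ∃ c, 0 ≤ c ∧ ∀ q ∈ M.Θ, ‖fderiv ℝ M.Jsharp q‖ ≤ c := by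
  rw [Jsharp_eq_rightInv]
  exact hM.bounded_comp_J fun A hA => contDiffAt_rightInv hA

theorem bounded_fderiv_nullProj : ∃ c, 0 ≤ c ∧ ∀ q ∈ M.Θ, ‖fderiv ℝ M.nullProj q‖ ≤ c := by
  have : M.nullProj = fun q => (fun A : Vec p →L[ℝ] Vec m =>
      ContinuousLinearMap.id ℝ (Vec p) - rightInv A ∘L A) (M.J q) := by
    funext q
    rw [nullProj, Jsharp_eq_rightInv]
  rw [this]
  exact hM.bounded_comp_J fun A hA =>
    contDiffAt_const.sub ((contDiffAt_rightInv hA).clm_comp contDiffAt_id)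

theorem bounded_nullProj : ∃ c, 0 ≤ c ∧ ∀ q ∈ M.Θ, ‖M.nullProj q‖ ≤ c := by
  obtain ⟨c, hc⟩ := hM.bounded_J
  obtain ⟨c', hc'⟩ := hM.bounded_Jsharp
  refine ⟨1 + |c'| * |c|, by positivity, fun q hq => ?_⟩
  refine (norm_sub_le _ _).trans (add_le_add ContinuousLinearMap.norm_id_le ?_)
  refine (ContinuousLinearMap.opNorm_comp_le _ _).trans ?_
  have h1 := (hc q hq).trans (le_abs_self c)
  have h2 := (hc' q hq).trans (le_abs_self c')
  gcongr

end Standing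

end Manipulator

/-! ### Gain matrices -/

section Gains

variable {k : ℕ} {A : Matrix (Fin k) (Fin k) ℝ}

theorem Matrix.PosDef.inner_act_pos (hA : A.PosDef) {v : Vec k} (hv : v ≠ 0) :
    0 < inner ℝ v (act A v) := by
  have h := hA.dotProduct_mulVec_pos (x := v.ofLp) (by simpa using hv)
  rw [act, Matrix.inner_toEuclideanCLM]
  simpa [dotProduct_comm] using h

theorem Matrix.PosDef.inner_act_nonneg (hA : A.PosDef) (v : Vec k) :
    0 ≤ inner ℝ v (act A v) := by
  by_cases hv : v = 0
  · simp [hv]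
  · exact (hA.inner_act_pos hv).le

/-- The constant is the minimum of the quadratic form on the unit sphere. -/
theorem exists_mul_norm_sq_le_inner {E : Type*} [NormedAddCommGroup E] [InnerProductSpace ℝ E]
    [FiniteDimensional ℝ E] {T : E →L[ℝ] E} (hT : ∀ v ≠ 0, 0 < inner ℝ v (T v)) :
    ∃ c > 0, ∀ v, c * ‖v‖ ^ 2 ≤ inner ℝ v (T v) := by
  rcases subsingleton_or_nontrivial E with hE | hE
  · exact ⟨1, one_pos, fun v => by simp [Subsingleton.elim v 0]⟩
  obtain ⟨u, hu, hmin⟩ := (isCompact_sphere (0 : E) 1).exists_isMinOn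
    (NormedSpace.sphere_nonempty.2 zero_le_one)
    (f := fun v => inner ℝ v (T v)) (by fun_prop)
  have hu1 : ‖u‖ = 1 := by simpa using hu
  refine ⟨inner ℝ u (T u), hT u (by rintro rfl; simp at hu1), fun v => ?_⟩
  by_cases hv : v = 0
  · simp [hv]
  have hv' : ‖v‖ ≠ 0 := norm_ne_zero_iff.2 hv
  have h := hmin (show ‖v‖⁻¹ • v ∈ Metric.sphere (0 : E) 1 by simp [norm_smul, hv'])
  simp only [Set.mem_ofPred_eq, map_smul, inner_smul_left, inner_smul_right] at h
  calc inner ℝ u (T u) * ‖v‖ ^ 2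
      ≤ (‖v‖⁻¹ * (‖v‖⁻¹ * inner ℝ v (T v))) * ‖v‖ ^ 2 := by gcongr; simpa using h
    _ = inner ℝ v (T v) := by field_simp

theorem Matrix.PosDef.exists_mul_norm_sq_le_inner_act (hA : A.PosDef) :
    ∃ c > 0, ∀ v : Vec k, c * ‖v‖ ^ 2 ≤ inner ℝ v (act A v) :=
  exists_mul_norm_sq_le_inner (T := Matrix.toEuclideanCLM (𝕜 := ℝ) A)
    fun _ hv => hA.inner_act_pos hv

theorem Matrix.PosDef.act_inv_act (hA : A.PosDef) (v : Vec k) : act A⁻¹ (act A v) = v := by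
  have h : A⁻¹ * A = 1 := Matrix.nonsing_inv_mul A ((Matrix.isUnit_iff_isUnit_det A).1 hA.isUnit)
  have := congrArg (fun B => Matrix.toEuclideanCLM (𝕜 := ℝ) B v) h
  simpa [act] using this

theorem Matrix.IsHermitian.inner_act_comm (hA : A.IsHermitian) (v w : Vec k) :
    inner ℝ v (act A w) = inner ℝ w (act A v) := by
  have hA' : A.transpose = A := by simpa [Matrix.IsHermitian] using hA
  rw [act, act, Matrix.inner_toEuclideanCLM, Matrix.inner_toEuclideanCLM,
    Matrix.dotProduct_mulVec, ← Matrix.mulVec_transpose, hA', dotProduct_comm]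

theorem norm_act_le (A : Matrix (Fin k) (Fin k) ℝ) (v : Vec k) :
    ‖act A v‖ ≤ ‖Matrix.toEuclideanCLM (𝕜 := ℝ) A‖ * ‖v‖ :=
  (Matrix.toEuclideanCLM (𝕜 := ℝ) A).le_opNorm v

theorem lambdaMin_le_diag (hA : A.IsDiag) (j : Fin k) : lambdaMin A ≤ A j j := by
  have h : spectrum ℝ A = Set.range A.diag := by
    conv_lhs => rw [← hA.diagonal_diag]
    exact spectrum_diagonal _
  refine csInf_le A.finite_real_spectrum.bddBelow ?_
  rw [h]
  exact ⟨j, rfl⟩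

theorem inner_act_of_isDiag (hA : A.IsDiag) (v w : Vec k) :
    inner ℝ v (act A w) = ∑ j, A j j * (v j * w j) := by
  rw [act, PiLp.inner_apply]
  refine Finset.sum_congr rfl fun j _ => ?_
  rw [Matrix.ofLp_toEuclideanCLM, Matrix.mulVec, dotProduct, Finset.sum_eq_single j]
  · simp; ring
  · intro i _ hij
    rw [hA hij.symm, zero_mul]
  · simp

theorem EuclideanSpace.norm_le_sum_abs (v : Vec k) : ‖v‖ ≤ ∑ j, |v j| := by
  refine abs_le_of_sq_le_sq' ?_ (Finset.sum_nonneg fun j _ => abs_nonneg _) |>.2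
  rw [EuclideanSpace.norm_sq_eq]
  exact Finset.sum_sq_le_sq_sum_of_nonneg fun j _ => abs_nonneg _

theorem norm_sgn_le (v : Vec k) : ‖sgn v‖ ≤ k := by
  refine (EuclideanSpace.norm_le_sum_abs _).trans ?_
  refine (Finset.sum_le_card_nsmul _ _ 1 fun j _ => ?_).trans (by simp)
  rcases Real.sign_apply_eq (v j) with h | h | h <;> simp [sgn, h]

/-- The switching term dominates every disturbance bounded by the minimum eigenvalue. -/
theorem lambdaMin_mul_norm_le_inner_act_sgn (hA : A.IsDiag) (h0 : 0 ≤ lambdaMin A) (v : Vec k) :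
    lambdaMin A * ‖v‖ ≤ inner ℝ v (act A (sgn v)) := by
  rw [inner_act_of_isDiag hA]
  calc lambdaMin A * ‖v‖ ≤ lambdaMin A * ∑ j, |v j| := by
        gcongr; exact EuclideanSpace.norm_le_sum_abs v
    _ = ∑ j, lambdaMin A * |v j| := Finset.mul_sum _ _ _
    _ ≤ _ := by
        refine Finset.sum_le_sum fun j _ => ?_
        have : v j * sgn v j = |v j| := by
          simp only [sgn]
          rcases lt_trichotomy (v j) 0 with h | h | h
          · rw [Real.sign_of_neg h, abs_of_neg h]; ring
          · simp [h]
          · rw [Real.sign_of_pos h, abs_of_pos h]; ring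
        rw [this]
        gcongr
        exact lambdaMin_le_diag hA j

/-- The left factor is frozen at `s x`. A coordinate that vanishes there has weight zero, and the
sign of any other coordinate is locally constant; a diagonal `A` does not mix the two kinds. -/
theorem continuousAt_inner_act_sgn {X : Type*} [TopologicalSpace X] (hA : A.IsDiag)
    {s : X → Vec k} {x : X} (hs : ContinuousAt s x) :
    ContinuousAt (fun y => inner ℝ (s x) (act A (sgn (s y)))) x := by
  simp only [inner_act_of_isDiag hA]
  refine tendsto_finsetSum _ fun j _ => ?_
  refine Tendsto.const_mul _ (tendsto_nhds_of_eventually_eq ?_)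
  have hsj : ContinuousAt (fun y => s y j) x :=
    ((EuclideanSpace.proj (𝕜 := ℝ) j : Vec k →L[ℝ] ℝ).continuous.continuousAt).comp hs
  simp only [sgn]
  rcases lt_trichotomy (s x j) 0 with h | h | h
  · filter_upwards [hsj.eventually (gt_mem_nhds h)] with y hy
    rw [Real.sign_of_neg h, Real.sign_of_neg hy]
  · simp [h]
  · filter_upwards [hsj.eventually (lt_mem_nhds h)] with y hy
    rw [Real.sign_of_pos h, Real.sign_of_pos hy]

end Gains

/-! ### Closed-loop dynamics of one manipulator -/

section Node

variable {m p r : ℕ} {M : Manipulator m p r} {K : Controller m p r} {t₀ : ℝ}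

theorem Manipulator.Standing.isInvertible_H (hM : M.Standing t₀) {q : Vec p} (hq : q ∈ M.Θ) :
    (M.H q).IsInvertible := by
  obtain ⟨h, hpos, hH⟩ := hM.posDef_H
  refine .of_injective ((injective_iff_map_eq_zero _).2 fun v hv => ?_)
  have := hH q hq v
  rw [hv, inner_zero_right] at this
  have h2 : ‖v‖ ^ 2 ≤ 0 := by
    by_contra! hcon
    exact absurd (mul_pos hpos hcon) (not_lt.2 this)
  simpa using h2

theorem contDiffAt_nullProj_subtask (hM : M.Standing t₀) (hK : K.Admissible M t₀) {q : Vec p}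
    (hq : q ∈ M.Θ) (t : ℝ) :
    ContDiffAt ℝ 1 (fun y : ℝ × Vec p => M.nullProj y.2 (K.φ y.1 y.2)) (t, q) :=
  (ContDiffAt.comp (t, q) (g := M.nullProj) (hM.contDiffAt_nullProj hq) contDiffAt_snd).clm_apply hK.smooth_φ.contDiffAt

theorem contDiffAt_auxVel (hM : M.Standing t₀) (hK : K.Admissible M t₀) (t : ℝ)
    {z : NodeState m p r} (hq : z.q ∈ M.Θ) :
    ContDiffAt ℝ 1 (fun y : ℝ × NodeState m p r => auxVel M K y.1 y.2) (t, z) := by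
  have hψ : ContDiff ℝ 1 M.ψ := hM.smooth_ψ.of_le (by norm_num)
  have hqd : ContDiff ℝ 1 (fun y : ℝ × NodeState m p r => y.2.1) := by fun_prop
  have h1 : ContDiffAt ℝ 1 (fun y : ℝ × NodeState m p r => M.Jsharp y.2.1) (t, z) :=
    ContDiffAt.comp (t, z) (g := M.Jsharp) (f := fun y : ℝ × NodeState m p r => y.2.1)
      (hM.contDiffAt_Jsharp hq) hqd.contDiffAt
  have h2 : ContDiff ℝ 1 (fun y : ℝ × NodeState m p r =>
      y.2.2.2.2.2.1 - K.α • (M.ψ y.2.1 - y.2.2.2.2.1)) := by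
    have := hψ.comp hqd
    fun_prop
  have h3 : ContDiffAt ℝ 1 (fun y : ℝ × NodeState m p r => M.nullProj y.2.1 (K.φ y.1 y.2.1))
      (t, z) :=
    (contDiffAt_nullProj_subtask hM hK hq t).comp (t, z)
      (f := fun y : ℝ × NodeState m p r => (y.1, y.2.1)) (by fun_prop)
  exact (h1.clm_apply h2.contDiffAt).add h3

theorem contDiffAt_sHat (hM : M.Standing t₀) (hK : K.Admissible M t₀) (t : ℝ)
    {z : NodeState m p r} (hq : z.q ∈ M.Θ) :
    ContDiffAt ℝ 1 (fun y : ℝ × NodeState m p r => sHat M K y.1 y.2) (t, z) :=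
  ContDiffAt.sub (f := fun y : ℝ × NodeState m p r => y.2.2.1) (by fun_prop)
    (contDiffAt_auxVel hM hK t hq)

theorem continuousAt_auxVel (hM : M.Standing t₀) (hK : K.Admissible M t₀) (t : ℝ)
    {z : NodeState m p r} (hq : z.q ∈ M.Θ) : ContinuousAt (auxVel M K t) z :=
  (contDiffAt_auxVel hM hK t hq).continuousAt.comp (f := fun z' : NodeState m p r => (t, z'))
    (by fun_prop)

theorem continuousAt_sHat (hM : M.Standing t₀) (hK : K.Admissible M t₀) (t : ℝ)
    {z : NodeState m p r} (hq : z.q ∈ M.Θ) : ContinuousAt (sHat M K t) z :=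
  (contDiffAt_sHat hM hK t hq).continuousAt.comp (f := fun z' : NodeState m p r => (t, z'))
    (by fun_prop)

theorem continuousAt_auxAcc (hM : M.Standing t₀) (hK : K.Admissible M t₀) (t : ℝ)
    {z : NodeState m p r} (hq : z.q ∈ M.Θ) : ContinuousAt (auxAcc M K t) z := by
  have hqc : ContinuousAt (fun y : NodeState m p r => y.1) z := by fun_prop
  have hψ : ContinuousAt (fun y : NodeState m p r => M.ψ y.1) z :=
    hM.smooth_ψ.continuous.continuousAt.comp hqc
  have hJ : ContinuousAt (fun y : NodeState m p r => M.J y.1) z :=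
    hM.contDiff_J.continuous.continuousAt.comp hqc
  have hJs : ContinuousAt (fun y : NodeState m p r => M.Jsharp y.1) z :=
    (hM.contDiffAt_Jsharp hq).continuousAt.comp hqc
  have hdJs : ContinuousAt (fun y : NodeState m p r => fderiv ℝ M.Jsharp y.1) z :=
    ((hM.contDiffAt_Jsharp hq).continuousAt_fderiv one_ne_zero).comp hqc
  have hdN : ContinuousAt (fun y : NodeState m p r =>
      fderiv ℝ (fun y : ℝ × Vec p => M.nullProj y.2 (K.φ y.1 y.2)) (t, y.1)) z :=
    ((contDiffAt_nullProj_subtask hM hK hq t).continuousAt_fderiv one_ne_zero).comp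
      (f := fun y : NodeState m p r => (t, y.1)) (by fun_prop)
  have hv : ContinuousAt (fun y : NodeState m p r => y.2.1) z := by fun_prop
  have hw : ContinuousAt (fun y : NodeState m p r => y.2.2.2.2.1 - K.α • (M.ψ y.1 - y.2.2.2.1)) z :=
    by fun_prop
  have hu : ContinuousAt (fun y : NodeState m p r =>
      y.2.2.2.2.2 - K.α • (M.J y.1 y.2.1 - y.2.2.2.2.1)) z := by
    have := hJ.clm_apply hv
    fun_prop
  exact (((hdJs.clm_apply hv).clm_apply hw).add (hJs.clm_apply hu)).add
    (hdN.clm_apply (by fun_prop))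

theorem continuousAt_regr (hM : M.Standing t₀) (hK : K.Admissible M t₀) (t : ℝ)
    {z : NodeState m p r} (hq : z.q ∈ M.Θ) : ContinuousAt (regr M K t) z := by
  have h1 := continuousAt_auxVel hM hK t hq
  have h2 := continuousAt_auxAcc hM hK t hq
  exact hM.continuous_Y.continuousAt.comp
    (f := fun z' : NodeState m p r => (z'.1, z'.2.1, auxVel M K t z', auxAcc M K t z'))
    (by fun_prop)

theorem continuousAt_adaptRate (hM : M.Standing t₀) (hK : K.Admissible M t₀) (t : ℝ)
    {z : NodeState m p r} (hq : z.q ∈ M.Θ) : ContinuousAt (adaptRate M K t) z := by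
  have h1 : ContinuousAt (fun z' => (regr M K t z').adjoint) z :=
    (contDiff_adjoint (n := 0)).continuous.continuousAt.comp (continuousAt_regr hM hK t hq)
  exact ((Matrix.toEuclideanCLM (𝕜 := ℝ) K.T).continuous.continuousAt.comp
    (h1.clm_apply (continuousAt_sHat hM hK t hq))).neg

/-- The joint acceleration is discontinuous only in directions that do not affect the kinetic
energy of `ŝ`. -/
theorem continuousAt_inner_jointAcc (hM : M.Standing t₀) (hK : K.Admissible M t₀) (t : ℝ)
    {z : NodeState m p r} (hq : z.q ∈ M.Θ) :
    ContinuousAt (fun z' => inner ℝ (sHat M K t z) (M.H z.q (jointAcc M K t z'))) z := by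
  have hqc : ContinuousAt (fun y : NodeState m p r => y.1) z := by fun_prop
  have hs := continuousAt_sHat hM hK t hq
  have hH : ContinuousAt (fun y : NodeState m p r => M.H z.1 ∘L (M.H y.1).inverse) z :=
    continuousAt_const.clm_comp <| ContinuousAt.comp (g := ContinuousLinearMap.inverse)
      (f := fun y : NodeState m p r => M.H y.1)
      ((hM.isInvertible_H hq).contDiffAt_map_inverse (n := 0)).continuousAt
      (hM.smooth_H.continuous.continuousAt.comp hqc)
  have hH1 : M.H z.1 ∘L (M.H z.1).inverse = ContinuousLinearMap.id ℝ (Vec p) :=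
    (hM.isInvertible_H hq).self_comp_inverse
  have hJ : ContinuousAt (fun y : NodeState m p r => M.J y.1) z :=
    hM.contDiff_J.continuous.continuousAt.comp hqc
  have hJt : ContinuousAt (fun y : NodeState m p r => (M.J y.1).adjoint) z :=
    (contDiff_adjoint (n := 0)).continuous.continuousAt.comp hJ
  have hreg := (continuousAt_regr hM hK t hq).clm_apply
    (show ContinuousAt (fun y : NodeState m p r => y.2.2.1) z by fun_prop)
  have hKx := hJt.clm_apply ((Matrix.toEuclideanCLM (𝕜 := ℝ) K.Kx).continuous.continuousAt.comp
    (hJ.clm_apply hs))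
  have hKs := (Matrix.toEuclideanCLM (𝕜 := ℝ) K.Ks).continuous.continuousAt.comp hs
  have hC : ContinuousAt (fun y : NodeState m p r => M.C y.1 y.2.1 y.2.1) z :=
    (hM.continuous_C.continuousAt.comp (f := fun y : NodeState m p r => (y.1, y.2.1))
      (by fun_prop)).clm_apply (by fun_prop)
  have hg : ContinuousAt (fun y : NodeState m p r => M.g y.1) z :=
    hM.continuous_g.continuousAt.comp hqc
  have hcont := (((((hreg.sub hKx).sub hKs).sub hC).sub hg).sub
    (continuousAt_const (y := M.d t)))
  have hreg_part := (continuousAt_const (y := sHat M K t z)).inner (𝕜 := ℝ) (hH.clm_apply hcont)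
  have hswitch := continuousAt_inner_act_sgn hK.Kr_diag hs
  -- Split `H(z) H(y)⁻¹ = I + error` in front of the switching term: the identity gives `hswitch`,
  -- and here a vanishing error multiplies a bounded signum.
  have hcross : ContinuousAt (fun y => inner ℝ (sHat M K t z)
      ((M.H z.1 ∘L (M.H y.1).inverse - ContinuousLinearMap.id ℝ (Vec p))
        (act K.Kr (sgn (sHat M K t y))))) z := by
    have hval : inner ℝ (sHat M K t z)
      ((M.H z.1 ∘L (M.H z.1).inverse - ContinuousLinearMap.id ℝ (Vec p))
        (act K.Kr (sgn (sHat M K t z)))) = 0 := by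
      rw [hH1, sub_self]; simp
    rw [ContinuousAt, hval]
    set b := ‖Matrix.toEuclideanCLM (𝕜 := ℝ) K.Kr‖ * p
    have hlim : Tendsto (fun y : NodeState m p r => ‖sHat M K t z‖ *
        (‖M.H z.1 ∘L (M.H y.1).inverse - ContinuousLinearMap.id ℝ (Vec p)‖ * b)) (𝓝 z) (𝓝 0) := by
      have h1 : ContinuousAt (fun y : NodeState m p r => ‖sHat M K t z‖ *
        (‖M.H z.1 ∘L (M.H y.1).inverse - ContinuousLinearMap.id ℝ (Vec p)‖ * b)) z :=
        continuousAt_const.mul ((hH.sub continuousAt_const).norm.mul continuousAt_const)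
      have h2 := h1.tendsto
      rwa [hH1, sub_self, norm_zero, zero_mul, mul_zero] at h2
    refine squeeze_zero_norm (fun y => ?_) hlim
    refine (norm_inner_le_norm _ _).trans ?_
    gcongr
    refine (ContinuousLinearMap.le_opNorm _ _).trans ?_
    gcongr
    exact (norm_act_le _ _).trans (mul_le_mul_of_nonneg_left (norm_sgn_le _) (norm_nonneg _))
  convert (hreg_part.sub hswitch).sub hcross using 1
  funext y
  simp only [jointAcc, torque, Pi.sub_apply, Function.comp_apply, sub_apply,
    ContinuousLinearMap.comp_apply, ContinuousLinearMap.id_apply, map_sub, inner_sub_right, act]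
  ring

end Node

/-! ### Exponentially stable linear systems with a decaying input -/

section StableLinear

variable {E : Type*} [NormedAddCommGroup E] [InnerProductSpace ℝ E] {e u : ℝ → E} {α T : ℝ}

theorem norm_sq_le_of_ae_deriv_eq {b : ℝ} (hα : 0 < α) (hb : ∀ t, T ≤ t → ‖u t‖ ≤ b)
    (he : ∀ t, T ≤ t → AbsolutelyContinuousOnInterval e T t)
    (hd : ∀ᵐ t : ℝ, T < t → HasDerivAt e (u t - α • e t) t) {t : ℝ} (ht : T ≤ t) :
    ‖e t‖ ^ 2 ≤
      Real.exp (-α * (t - T)) * (‖e T‖ ^ 2 - b ^ 2 / α / α) + b ^ 2 / α / α := by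
  refine AbsolutelyContinuousOnInterval.le_of_ae_deriv_le_neg_mul_add
    (y := fun t => ‖e t‖ ^ 2) hα (fun t ht => ?_) ?_ ht
  · exact ContDiffAt.comp_absolutelyContinuousOnInterval (f := fun v : E => ‖v‖ ^ 2)
      (fun s _ => (contDiff_norm_sq ℝ).contDiffAt) (he t ht)
  · filter_upwards [hd] with t h hTt
    refine ⟨_, ?_, (h hTt).norm_sq⟩
    rw [inner_sub_right, inner_smul_right, real_inner_self_eq_norm_sq]
    have h1 : inner ℝ (e t) (u t) ≤ ‖e t‖ * b :=
      (real_inner_le_norm _ _).trans (by gcongr; exact hb t hTt.le)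
    -- Young's inequality spends half of the decay `2α‖e‖²` on the input.
    have h2 : 2 * (‖e t‖ * b) ≤ α * ‖e t‖ ^ 2 + b ^ 2 / α := by
      have : 0 ≤ (α * ‖e t‖ - b) ^ 2 / α := by positivity
      have h3 : (α * ‖e t‖ - b) ^ 2 / α = α * ‖e t‖ ^ 2 - 2 * (‖e t‖ * b) + b ^ 2 / α := by
        field_simp
        ring
      linarith
    linarith

theorem exists_norm_le_of_ae_deriv_eq {b : ℝ} (hα : 0 < α) (hb : ∀ t, T ≤ t → ‖u t‖ ≤ b)
    (he : ∀ t, T ≤ t → AbsolutelyContinuousOnInterval e T t)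
    (hd : ∀ᵐ t : ℝ, T < t → HasDerivAt e (u t - α • e t) t) :
    ∃ c, ∀ t, T ≤ t → ‖e t‖ ≤ c := by
  refine ⟨√(‖e T‖ ^ 2 + b ^ 2 / α / α), fun t ht => Real.le_sqrt_of_sq_le ?_⟩
  have h := norm_sq_le_of_ae_deriv_eq hα hb he hd ht
  have h1 : Real.exp (-α * (t - T)) ≤ 1 := Real.exp_le_one_iff.2 (by nlinarith)
  have h2 := Real.exp_pos (-α * (t - T))
  have h3 : 0 ≤ b ^ 2 / α / α := by positivity
  nlinarith [sq_nonneg ‖e T‖]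

theorem tendsto_zero_of_ae_deriv_eq (hα : 0 < α) (hu : Tendsto u atTop (𝓝 0))
    (he : ∀ t, T ≤ t → AbsolutelyContinuousOnInterval e T t)
    (hd : ∀ᵐ t : ℝ, T < t → HasDerivAt e (u t - α • e t) t) :
    Tendsto e atTop (𝓝 0) := by
  rw [tendsto_zero_iff_norm_tendsto_zero, Metric.tendsto_atTop']
  intro ε hε
  -- Restarted once the input is this small, the bound on `‖e‖²` tends to `ε²/4 < ε²`.
  have hev : ∀ᶠ t in atTop, ‖u t‖ ≤ α * (ε / 2) :=
    (tendsto_zero_iff_norm_tendsto_zero.1 hu).eventually (ge_mem_nhds (by positivity))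
  obtain ⟨S, hS⟩ := eventually_atTop.1 (hev.and (eventually_ge_atTop T))
  have hTS : T ≤ S := (hS S le_rfl).2
  have hbound : ∀ t, S ≤ t → ‖e t‖ ^ 2 ≤ Real.exp (-α * (t - S)) *
      (‖e S‖ ^ 2 - (α * (ε / 2)) ^ 2 / α / α) + (α * (ε / 2)) ^ 2 / α / α := fun t ht =>
    norm_sq_le_of_ae_deriv_eq hα (fun s hs => (hS s hs).1)
      (fun s hs => (he s (hTS.trans hs)).mono (by
        rw [Set.uIcc_of_le hs, Set.uIcc_of_le (hTS.trans hs)]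
        exact Set.Icc_subset_Icc_left hTS))
      (by filter_upwards [hd] with s h hs using h (hTS.trans_lt hs)) ht
  have hlim : Tendsto (fun t => Real.exp (-α * (t - S)) *
      (‖e S‖ ^ 2 - (α * (ε / 2)) ^ 2 / α / α) + (α * (ε / 2)) ^ 2 / α / α) atTop
      (𝓝 (0 * (‖e S‖ ^ 2 - (α * (ε / 2)) ^ 2 / α / α) + (α * (ε / 2)) ^ 2 / α / α)) := by
    refine (Tendsto.mul_const _ (Real.tendsto_exp_atBot.comp ?_)).add_const _
    exact (tendsto_atTop_add_const_right _ (-S) tendsto_id).const_mul_atTop_of_neg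
      (neg_lt_zero.2 hα)
  have hlt : 0 * (‖e S‖ ^ 2 - (α * (ε / 2)) ^ 2 / α / α) + (α * (ε / 2)) ^ 2 / α / α < ε ^ 2 := by
    have : (α * (ε / 2)) ^ 2 / α / α = ε ^ 2 / 4 := by field_simp; ring
    rw [this]
    nlinarith
  obtain ⟨N, hN⟩ := eventually_atTop.1 ((hlim.eventually (gt_mem_nhds hlt)).and
    (eventually_ge_atTop S))
  refine ⟨N, fun t ht => ?_⟩
  rw [dist_zero_right, norm_norm]
  exact lt_of_pow_lt_pow_left₀ 2 hε.le ((hbound t (hN t ht.le).2).trans_lt (hN t ht.le).1)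

end StableLinear

section Node

variable {m p r : ℕ} {M : Manipulator m p r} {K : Controller m p r} {t₀ : ℝ}

/-! ### Bounds on the auxiliary signals -/

/-- `J J^♯ = I` and `J` kills the subtask term. Once `x̂` moves with velocity `v̂`, this is the
task-space error equation `ė = Jŝ - αe`. -/
theorem J_dq_eq (hM : M.Standing t₀) (t : ℝ) {z : NodeState m p r} (hq : z.q ∈ M.Θ) :
    M.J z.q z.dq = M.J z.q (sHat M K t z) + z.vh - K.α • (M.ψ z.q - z.xh) := by
  rw [sHat, auxVel, map_sub, map_add, hM.J_Jsharp hq, hM.J_nullProj hq]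
  abel

theorem subtaskError_eq (hM : M.Standing t₀) (t : ℝ) {z : NodeState m p r} (hq : z.q ∈ M.Θ) :
    subtaskError M K t z = M.nullProj z.q (sHat M K t z) := by
  rw [subtaskError, sHat, auxVel, map_sub, map_sub, map_add, hM.nullProj_Jsharp hq,
    hM.nullProj_nullProj hq, zero_add]

/-- The assumption is on `x - x̂` and not on positions, since the leader may travel arbitrarily far.
-/
theorem exists_bound_auxVel (hM : M.Standing t₀) (hK : K.Admissible M t₀) (R : ℝ) :
    ∃ c, ∀ t, t₀ ≤ t → ∀ z : NodeState m p r, z.q ∈ M.Θ → ‖M.ψ z.q - z.xh‖ ≤ R → ‖z.vh‖ ≤ R →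
      ‖auxVel M K t z‖ ≤ c := by
  obtain ⟨a, ha⟩ := hM.bounded_Jsharp
  obtain ⟨b, hb0, hb⟩ := hM.bounded_nullProj
  obtain ⟨f, hf⟩ := hK.bounded_φ
  have hα := hK.α_pos
  refine ⟨a * (R + K.α * R) + b * f, fun t ht z hq he hv => ?_⟩
  have ha0 : 0 ≤ a := (norm_nonneg _).trans (ha _ hq)
  refine (norm_add_le _ _).trans (add_le_add ?_ ?_)
  · refine (ContinuousLinearMap.le_of_opNorm_le _ (ha _ hq) _).trans ?_
    gcongr
    refine (norm_sub_le _ _).trans (add_le_add hv ?_)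
    rw [norm_smul, Real.norm_of_nonneg hα.le]
    gcongr
  · refine (ContinuousLinearMap.le_of_opNorm_le _ (hb _ hq) _).trans ?_
    gcongr
    exact hf t ht _ hq

theorem exists_bound_auxAcc (hM : M.Standing t₀) (hK : K.Admissible M t₀) (R : ℝ) :
    ∃ c, ∀ t, t₀ ≤ t → ∀ z : NodeState m p r, z.q ∈ M.Θ → ‖z.dq‖ ≤ R → ‖M.ψ z.q - z.xh‖ ≤ R →
      ‖z.vh‖ ≤ R → ‖z.ah‖ ≤ R → ‖auxAcc M K t z‖ ≤ c := by
  obtain ⟨j, hj⟩ := hM.bounded_J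
  obtain ⟨a, ha⟩ := hM.bounded_Jsharp
  obtain ⟨a', ha0', ha'⟩ := hM.bounded_fderiv_Jsharp
  obtain ⟨b, hb0, hb⟩ := hM.bounded_nullProj
  obtain ⟨b', hb0', hb'⟩ := hM.bounded_fderiv_nullProj
  obtain ⟨f, hf⟩ := hK.bounded_φ
  obtain ⟨f', hf'⟩ := hK.bounded_dφ
  have hα := hK.α_pos
  refine ⟨a' * R * (R + K.α * R) + a * (R + K.α * (j * R + R)) + (b * (f' * (1 + R)) + b' * R * f),
    fun t ht z hq hdq he hv hah => ?_⟩
  have ha0 : 0 ≤ a := (norm_nonneg _).trans (ha _ hq)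
  have hR0 : 0 ≤ R := (norm_nonneg _).trans hdq
  have hf0' : 0 ≤ f' := (norm_nonneg _).trans (hf' t ht _ hq)
  refine (norm_add_le _ _).trans (add_le_add ((norm_add_le _ _).trans (add_le_add ?_ ?_)) ?_)
  · refine (ContinuousLinearMap.le_opNorm₂ _ _ _).trans ?_
    gcongr
    · exact ha' _ hq
    · refine (norm_sub_le _ _).trans (add_le_add hv ?_)
      rw [norm_smul, Real.norm_of_nonneg hα.le]
      gcongr
  · refine (ContinuousLinearMap.le_of_opNorm_le _ (ha _ hq) _).trans ?_
    gcongr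
    refine (norm_sub_le _ _).trans (add_le_add hah ?_)
    rw [norm_smul, Real.norm_of_nonneg hα.le]
    gcongr
    refine (norm_sub_le _ _).trans (add_le_add ?_ hv)
    exact (ContinuousLinearMap.le_of_opNorm_le_of_le _ (hj _ hq) hdq)
  · have hN : HasFDerivAt (fun y : ℝ × Vec p => M.nullProj y.2)
        (fderiv ℝ M.nullProj z.q ∘L ContinuousLinearMap.snd ℝ ℝ (Vec p)) (t, z.q) :=
      HasFDerivAt.comp (t, z.q) (g := M.nullProj) (f := Prod.snd)
        ((hM.contDiffAt_nullProj hq).differentiableAt one_ne_zero).hasFDerivAt hasFDerivAt_snd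
    have hφ : HasFDerivAt (fun y : ℝ × Vec p => K.φ y.1 y.2) _ (t, z.q) :=
      (hK.smooth_φ.differentiable one_ne_zero (t, z.q)).hasFDerivAt
    rw [(hN.clm_apply hφ).fderiv]
    simp only [add_apply, ContinuousLinearMap.comp_apply, ContinuousLinearMap.flip_apply,
      ContinuousLinearMap.coe_snd']
    refine (norm_add_le _ _).trans (add_le_add ?_ ?_)
    · refine ContinuousLinearMap.le_of_opNorm_le_of_le _ (hb _ hq) ?_
      refine ContinuousLinearMap.le_of_opNorm_le_of_le _ (hf' t ht _ hq) ?_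
      rw [Prod.norm_mk, norm_one]
      exact max_le (by linarith) (by linarith)
    · refine (ContinuousLinearMap.le_opNorm₂ _ _ _).trans ?_
      gcongr
      · exact hb' _ hq
      · exact hf t ht _ hq

theorem exists_bound_regr (hM : M.Standing t₀) (hK : K.Admissible M t₀) (R : ℝ) :
    ∃ c, ∀ t, t₀ ≤ t → ∀ z : NodeState m p r, z.q ∈ M.Θ → ‖sHat M K t z‖ ≤ R →
      ‖M.ψ z.q - z.xh‖ ≤ R → ‖z.vh‖ ≤ R → ‖z.ah‖ ≤ R → ‖regr M K t z‖ ≤ c := by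
  obtain ⟨a, ha⟩ := exists_bound_auxVel hM hK R
  -- `R + a` bounds `q̇ = ŝ + auxVel`; the auxiliary acceleration can only be bounded after the
  -- velocities.
  obtain ⟨b, hb⟩ := exists_bound_auxAcc hM hK (max R (R + a))
  obtain ⟨c, hc⟩ := hM.bounded_Y (max (max R (R + a)) (max a b))
  refine ⟨c, fun t ht z hq hs he hv hah => ?_⟩
  have h1 := ha t ht z hq he hv
  have hdq : ‖z.dq‖ ≤ R + a := by
    have : z.dq = sHat M K t z + auxVel M K t z := by simp [sHat]
    rw [this]
    exact (norm_add_le _ _).trans (add_le_add hs h1)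
  have h2 := hb t ht z hq (hdq.trans (le_max_right _ _)) (he.trans (le_max_left _ _))
    (hv.trans (le_max_left _ _)) (hah.trans (le_max_left _ _))
  exact hc _ hq _ _ _ ((hdq.trans (le_max_right _ _)).trans (le_max_left _ _))
    ((h1.trans (le_max_left _ _)).trans (le_max_right _ _))
    ((h2.trans (le_max_right _ _)).trans (le_max_right _ _))

/-! ### Derivatives along a motion -/

namespace NodeState

variable (m p r)

/-- The projection of the state to the joint position. -/
def qL : NodeState m p r →L[ℝ] Vec p := .fst ℝ _ _

/-- The projection of the state to the joint velocity. -/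
def dqL : NodeState m p r →L[ℝ] Vec p := .fst ℝ _ _ ∘L .snd ℝ _ _

/-- The projection of the state to the parameter estimate. -/
def estL : NodeState m p r →L[ℝ] Vec r := .fst ℝ _ _ ∘L .snd ℝ _ _ ∘L .snd ℝ _ _

/-- The projection of the state to the estimate of the leader's position. -/
def xhL : NodeState m p r →L[ℝ] Vec m :=
  .fst ℝ _ _ ∘L .snd ℝ _ _ ∘L .snd ℝ _ _ ∘L .snd ℝ _ _

/-- The projection of the state to the estimate of the leader's velocity. -/
def vhL : NodeState m p r →L[ℝ] Vec m :=
  .fst ℝ _ _ ∘L .snd ℝ _ _ ∘L .snd ℝ _ _ ∘L .snd ℝ _ _ ∘L .snd ℝ _ _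

/-- The projection of the state to the estimate of the leader's acceleration. -/
def ahL : NodeState m p r →L[ℝ] Vec m :=
  .snd ℝ _ _ ∘L .snd ℝ _ _ ∘L .snd ℝ _ _ ∘L .snd ℝ _ _ ∘L .snd ℝ _ _

end NodeState

theorem ContinuousLinearMap.hasDerivAt_comp {E F : Type*} [NormedAddCommGroup E] [NormedSpace ℝ E]
    [NormedAddCommGroup F] [NormedSpace ℝ F] (ℓ : E →L[ℝ] F) {z : ℝ → E} {w : E} {t : ℝ}
    (hz : HasDerivAt z w t) : HasDerivAt (fun t => ℓ (z t)) (ℓ w) t :=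
  ℓ.hasFDerivAt.comp_hasDerivAt t hz

/-- `auxAcc` uses `v̂` and `â` in place of the derivatives of `x̂` and `v̂`, hence the consistency
hypotheses `hwx` and `hwv`. -/
theorem hasDerivAt_auxVel (hM : M.Standing t₀) (hK : K.Admissible M t₀) {t : ℝ}
    {z : ℝ → NodeState m p r} {w : NodeState m p r} (hq : (z t).q ∈ M.Θ) (hz : HasDerivAt z w t)
    (hwq : w.q = (z t).dq) (hwx : w.xh = (z t).vh) (hwv : w.vh = (z t).ah) :
    HasDerivAt (fun t => auxVel M K t (z t)) (auxAcc M K t (z t)) t := by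
  have hq' : HasDerivAt (fun t => (z t).1) (z t).2.1 t :=
    ((NodeState.qL m p r).hasDerivAt_comp hz).congr_deriv hwq
  have hx' : HasDerivAt (fun t => (z t).2.2.2.1) (z t).2.2.2.2.1 t :=
    ((NodeState.xhL m p r).hasDerivAt_comp hz).congr_deriv hwx
  have hv' : HasDerivAt (fun t => (z t).2.2.2.2.1) (z t).2.2.2.2.2 t :=
    ((NodeState.vhL m p r).hasDerivAt_comp hz).congr_deriv hwv
  have hψ := (hM.hasFDerivAt_ψ (z t).1).comp_hasDerivAt t hq'
  have hJs := ((hM.contDiffAt_Jsharp hq).differentiableAt one_ne_zero).hasFDerivAt.comp_hasDerivAt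
    t hq'
  have hN := ((contDiffAt_nullProj_subtask hM hK hq t).differentiableAt
    one_ne_zero).hasFDerivAt.comp_hasDerivAt t ((hasDerivAt_id t).prodMk hq')
  exact (hJs.clm_apply (hv'.sub ((hψ.sub hx').const_smul K.α))).add hN

/-- The kinetic energy `½ ŝᵀ H ŝ` of the velocity error. -/
noncomputable def errorEnergy (M : Manipulator m p r) (K : Controller m p r) (t : ℝ)
    (z : NodeState m p r) : ℝ :=
  1 / 2 * inner ℝ (sHat M K t z) (M.H z.q (sHat M K t z))

/-- The energy `½ ϑ̃ᵀ T⁻¹ ϑ̃` of the parameter error. -/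
noncomputable def paramEnergy (M : Manipulator m p r) (K : Controller m p r)
    (z : NodeState m p r) : ℝ :=
  1 / 2 * inner ℝ (z.est - M.ϑ) (act K.T⁻¹ (z.est - M.ϑ))

/-- The power supplied to the velocity error by the feedback terms and the disturbance. -/
noncomputable def feedbackPower (M : Manipulator m p r) (K : Controller m p r) (t : ℝ)
    (z : NodeState m p r) : ℝ :=
  - inner ℝ (M.J z.q (sHat M K t z)) (act K.Kx (M.J z.q (sHat M K t z)))
    - inner ℝ (sHat M K t z) (act K.Ks (sHat M K t z))
    - inner ℝ (sHat M K t z) (act K.Kr (sgn (sHat M K t z)))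
    - inner ℝ (sHat M K t z) (M.d t)

/-- Skew symmetry turns `½ ŝᵀḢŝ` into `ŝᵀCŝ`, and the remaining model terms combine to `Yϑ` by
linear parametrization. Only the pairing of `H q̈` with `ŝ` enters, so `hwdq` suffices although `q̈`
itself may be undetermined on a switching surface. -/
theorem hasDerivAt_errorEnergy (hM : M.Standing t₀) (hK : K.Admissible M t₀) {t : ℝ}
    {z : ℝ → NodeState m p r} {w : NodeState m p r} (hq : (z t).q ∈ M.Θ) (hz : HasDerivAt z w t)
    (hwq : w.q = (z t).dq) (hwx : w.xh = (z t).vh) (hwv : w.vh = (z t).ah)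
    (hwdq : inner ℝ (sHat M K t (z t)) (M.H (z t).q w.dq) =
      inner ℝ (sHat M K t (z t)) (M.H (z t).q (jointAcc M K t (z t)))) :
    HasDerivAt (fun t => errorEnergy M K t (z t))
      (inner ℝ (sHat M K t (z t)) (regr M K t (z t) ((z t).est - M.ϑ))
        + feedbackPower M K t (z t)) t := by
  have hq' : HasDerivAt (fun t => (z t).1) (z t).2.1 t :=
    ((NodeState.qL m p r).hasDerivAt_comp hz).congr_deriv hwq
  have hs : HasDerivAt (fun t => sHat M K t (z t)) (w.dq - auxAcc M K t (z t)) t :=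
    ((NodeState.dqL m p r).hasDerivAt_comp hz).sub (hasDerivAt_auxVel hM hK hq hz hwq hwx hwv)
  have hH := (hM.smooth_H.differentiable one_ne_zero (z t).1).hasFDerivAt.comp_hasDerivAt t hq'
  refine ((HasDerivAt.inner ℝ hs (hH.clm_apply hs)).const_mul (1 / 2 : ℝ)).congr_deriv ?_
  have hself : ∀ v w, inner ℝ v (M.H (z t).1 w) = inner ℝ w (M.H (z t).1 v) := fun v w => by
    rw [← ContinuousLinearMap.adjoint_inner_left, ← ContinuousLinearMap.star_eq_adjoint,
      (hM.selfAdjoint_H _ hq).star_eq, real_inner_comm]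
  have hskew := hM.skew _ hq (z t).2.1 (sHat M K t (z t))
  have hreg := congrArg (inner ℝ (sHat M K t (z t)))
    (hM.regressor _ hq (z t).2.1 (auxVel M K t (z t)) (auxAcc M K t (z t)))
  have hacc : M.H (z t).1 (jointAcc M K t (z t)) = torque M K t (z t)
      - M.C (z t).1 (z t).2.1 (z t).2.1 - M.g (z t).1 - M.d t :=
    (hM.isInvertible_H hq).self_apply_inverse _
  rw [Function.comp_apply, hself (w.dq - auxAcc M K t (z t))]
  simp only [map_sub, inner_add_right, inner_sub_right, sub_apply,
    smul_apply, inner_smul_right] at hskew hreg ⊢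
  have hCs : inner ℝ (sHat M K t (z t)) (M.C (z t).1 (z t).2.1 (sHat M K t (z t))) =
      inner ℝ (sHat M K t (z t)) (M.C (z t).1 (z t).2.1 (z t).2.1) -
      inner ℝ (sHat M K t (z t)) (M.C (z t).1 (z t).2.1 (auxVel M K t (z t))) := by
    rw [← inner_sub_right, ← map_sub]
    rfl
  rw [hwdq, hacc]
  simp only [torque, feedbackPower, inner_sub_right, ContinuousLinearMap.adjoint_inner_right]
  change _ = inner ℝ _ (regr M K t (z t) M.ϑ) at hreg
  linarith

/-- `T⁻¹` undoes the gain of the adaptation law; the result cancels the parameter term in the rate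
of `errorEnergy`. -/
theorem hasDerivAt_paramEnergy (hK : K.Admissible M t₀) {t : ℝ}
    {z : ℝ → NodeState m p r} {w : NodeState m p r} (hz : HasDerivAt z w t)
    (hwe : w.est = adaptRate M K t (z t)) :
    HasDerivAt (fun t => paramEnergy M K (z t))
      (- inner ℝ (sHat M K t (z t)) (regr M K t (z t) ((z t).est - M.ϑ))) t := by
  have he : HasDerivAt (fun t => (z t).2.2.1 - M.ϑ) (adaptRate M K t (z t)) t :=
    (((NodeState.estL m p r).hasDerivAt_comp hz).congr_deriv hwe).sub_const _
  have hT := (Matrix.toEuclideanCLM (𝕜 := ℝ) K.T⁻¹).hasFDerivAt.comp_hasDerivAt t he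
  refine ((HasDerivAt.inner ℝ he hT).const_mul (1 / 2 : ℝ)).congr_deriv ?_
  have hinv : act K.T⁻¹ (adaptRate M K t (z t)) =
      -(regr M K t (z t)).adjoint (sHat M K t (z t)) := by
    have := hK.T_posDef.act_inv_act ((regr M K t (z t)).adjoint (sHat M K t (z t)))
    rw [adaptRate, act, map_neg]
    exact congrArg Neg.neg this
  have hcomm := hK.T_posDef.inv.isHermitian.inner_act_comm (adaptRate M K t (z t))
    ((z t).est - M.ϑ)
  change 1 / 2 * (inner ℝ ((z t).est - M.ϑ) (act K.T⁻¹ (adaptRate M K t (z t))) +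
    inner ℝ (adaptRate M K t (z t)) (act K.T⁻¹ ((z t).est - M.ϑ))) = _
  rw [hcomm, hinv, inner_neg_right, ContinuousLinearMap.adjoint_inner_right, real_inner_comm]
  ring

end Node

section Node

variable {m p r : ℕ} {M : Manipulator m p r} {K : Controller m p r} {t₀ : ℝ}

/-! ### Energy estimates -/

/-- `K_r` absorbs the disturbance, `K_x` only helps, and `K_s` supplies the decay. -/
theorem feedbackPower_le (hM : M.Standing t₀) (hK : K.Admissible M t₀) :
    ∃ c > 0, ∀ t, t₀ ≤ t → ∀ z : NodeState m p r,
      feedbackPower M K t z ≤ -c * ‖sHat M K t z‖ ^ 2 := by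
  obtain ⟨c, hc, h⟩ := hK.Ks_posDef.exists_mul_norm_sq_le_inner_act
  refine ⟨c, hc, fun t ht z => ?_⟩
  obtain ⟨D, hD⟩ := hM.bounded_d
  have hd : ‖M.d t‖ ≤ lambdaMin K.Kr := by
    refine le_trans ?_ hK.Kr_dominates
    exact le_ciSup (f := fun t : Set.Ici t₀ => ‖M.d t‖)
      ⟨D, by rintro _ ⟨s, rfl⟩; exact hD s s.2⟩ ⟨t, ht⟩
  have h1 := lambdaMin_mul_norm_le_inner_act_sgn hK.Kr_diag ((norm_nonneg _).trans hd)
    (sHat M K t z)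
  have h2 : -inner ℝ (sHat M K t z) (M.d t) ≤ lambdaMin K.Kr * ‖sHat M K t z‖ := by
    refine (neg_le_abs _).trans ((abs_real_inner_le_norm _ _).trans ?_)
    rw [mul_comm]
    gcongr
  have h3 := hK.Kx_posDef.inner_act_nonneg (M.J z.q (sHat M K t z))
  have h4 := h (sHat M K t z)
  rw [feedbackPower]
  linarith

theorem abs_inner_act_le {k : ℕ} (A : Matrix (Fin k) (Fin k) ℝ) {v w : Vec k} {a b : ℝ}
    (hv : ‖v‖ ≤ a) (hw : ‖w‖ ≤ b) :
    |inner ℝ v (act A w)| ≤ a * (‖Matrix.toEuclideanCLM (𝕜 := ℝ) A‖ * b) := by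
  have ha : 0 ≤ a := (norm_nonneg _).trans hv
  refine (abs_real_inner_le_norm _ _).trans (mul_le_mul hv ?_ (norm_nonneg _) ha)
  exact (norm_act_le A w).trans (by gcongr)

theorem exists_bound_feedbackPower (hM : M.Standing t₀) (R : ℝ) :
    ∃ c, ∀ t, t₀ ≤ t → ∀ z : NodeState m p r, z.q ∈ M.Θ → ‖sHat M K t z‖ ≤ R →
      |feedbackPower M K t z| ≤ c := by
  obtain ⟨j, hj⟩ := hM.bounded_J
  obtain ⟨D, hD⟩ := hM.bounded_d
  refine ⟨j * R * (‖Matrix.toEuclideanCLM (𝕜 := ℝ) K.Kx‖ * (j * R)) +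
    R * (‖Matrix.toEuclideanCLM (𝕜 := ℝ) K.Ks‖ * R) +
    R * (‖Matrix.toEuclideanCLM (𝕜 := ℝ) K.Kr‖ * p) + R * D, fun t ht z hq hs => ?_⟩
  have hJs : ‖M.J z.q (sHat M K t z)‖ ≤ j * R :=
    ContinuousLinearMap.le_of_opNorm_le_of_le _ (hj _ hq) hs
  have h1 := abs_le.1 (abs_inner_act_le K.Kx hJs hJs)
  have h2 := abs_le.1 (abs_inner_act_le K.Ks hs hs)
  have h3 := abs_le.1 (abs_inner_act_le K.Kr hs (norm_sgn_le (sHat M K t z)))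
  have h4 : |inner ℝ (sHat M K t z) (M.d t)| ≤ R * D :=
    (abs_real_inner_le_norm _ _).trans
      (mul_le_mul hs (hD t ht) (norm_nonneg _) ((norm_nonneg _).trans hs))
  have h4' := abs_le.1 h4
  rw [feedbackPower, abs_le]
  constructor <;> linarith

theorem errorEnergy_le (hM : M.Standing t₀) :
    ∃ c > 0, ∀ t, ∀ z : NodeState m p r, z.q ∈ M.Θ →
      errorEnergy M K t z ≤ c * ‖sHat M K t z‖ ^ 2 := by
  obtain ⟨c, hc⟩ := hM.bounded_H
  refine ⟨|c| + 1, by positivity, fun t z hq => ?_⟩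
  have h1 : inner ℝ (sHat M K t z) (M.H z.q (sHat M K t z)) ≤
      ‖sHat M K t z‖ * (|c| * ‖sHat M K t z‖) :=
    (real_inner_le_norm _ _).trans (mul_le_mul_of_nonneg_left
      (ContinuousLinearMap.le_of_opNorm_le _ ((hc _ hq).trans (le_abs_self c)) _) (norm_nonneg _))
  rw [errorEnergy]
  nlinarith [sq_nonneg ‖sHat M K t z‖, abs_nonneg c,
    mul_nonneg (abs_nonneg c) (sq_nonneg ‖sHat M K t z‖)]

theorem le_errorEnergy (hM : M.Standing t₀) :
    ∃ c > 0, ∀ t, ∀ z : NodeState m p r, z.q ∈ M.Θ →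
      c * ‖sHat M K t z‖ ^ 2 ≤ errorEnergy M K t z := by
  obtain ⟨c, hc, h⟩ := hM.posDef_H
  refine ⟨c / 2, by positivity, fun t z hq => ?_⟩
  have := h _ hq (sHat M K t z)
  rw [errorEnergy]
  linarith

theorem le_paramEnergy (hK : K.Admissible M t₀) :
    ∃ c > 0, ∀ z : NodeState m p r, c * ‖z.est - M.ϑ‖ ^ 2 ≤ paramEnergy M K z := by
  obtain ⟨c, hc, h⟩ := hK.T_posDef.inv.exists_mul_norm_sq_le_inner_act
  refine ⟨c / 2, by positivity, fun z => ?_⟩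
  have := h (z.est - M.ϑ)
  rw [paramEnergy]
  linarith

theorem contDiffAt_errorEnergy (hM : M.Standing t₀) (hK : K.Admissible M t₀) (t : ℝ)
    {z : NodeState m p r} (hq : z.q ∈ M.Θ) :
    ContDiffAt ℝ 1 (fun y : ℝ × NodeState m p r => errorEnergy M K y.1 y.2) (t, z) := by
  have hs := contDiffAt_sHat hM hK t hq
  have hH : ContDiffAt ℝ 1 (fun y : ℝ × NodeState m p r => M.H y.2.1) (t, z) :=
    (hM.smooth_H.comp (f := fun y : ℝ × NodeState m p r => y.2.1) (by fun_prop)).contDiffAt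
  exact contDiffAt_const.mul (hs.inner ℝ (hH.clm_apply hs))

theorem contDiff_paramEnergy : ContDiff ℝ 1 (paramEnergy M K) := by
  have h : ContDiff ℝ 1 (fun z : NodeState m p r => z.2.2.1 - M.ϑ) := by fun_prop
  exact contDiff_const.mul
    (h.inner ℝ ((Matrix.toEuclideanCLM (𝕜 := ℝ) K.T⁻¹).contDiff.comp h))

/-- Along a motion whose estimates are consistent, the task-space errors and the subtask error
vanish asymptotically. -/
theorem tendsto_of_consistent_estimates (hM : M.Standing t₀) (hK : K.Admissible M t₀)
    {z : ℝ → NodeState m p r} {T R : ℝ} (hT : t₀ ≤ T)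
    (hz : ∀ t, T ≤ t → AbsolutelyContinuousOnInterval z T t)
    (hΘ : ∀ t, T ≤ t → (z t).q ∈ M.Θ)
    (hvR : ∀ t, T ≤ t → ‖(z t).vh‖ ≤ R) (haR : ∀ t, T ≤ t → ‖(z t).ah‖ ≤ R)
    (hd : ∀ᵐ t : ℝ, T < t → ∃ w : NodeState m p r, HasDerivAt z w t ∧ w.q = (z t).dq ∧
      inner ℝ (sHat M K t (z t)) (M.H (z t).q w.dq) =
        inner ℝ (sHat M K t (z t)) (M.H (z t).q (jointAcc M K t (z t))) ∧
      w.est = adaptRate M K t (z t) ∧ w.xh = (z t).vh ∧ w.vh = (z t).ah) :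
    Tendsto (fun t => M.ψ (z t).q - (z t).xh) atTop (𝓝 0) ∧
      Tendsto (fun t => M.J (z t).q (z t).dq - (z t).vh) atTop (𝓝 0) ∧
      Tendsto (fun t => subtaskError M K t (z t)) atTop (𝓝 0) := by
  set s := fun t => sHat M K t (z t) with hsdef
  set e := fun t => M.ψ (z t).q - (z t).xh with hedef
  set W := fun t => errorEnergy M K t (z t) with hWdef
  set A := fun t => paramEnergy M K (z t) with hAdef
  obtain ⟨k, hk, hfp⟩ := feedbackPower_le hM hK
  obtain ⟨c₁, hc₁, hWup⟩ := errorEnergy_le (K := K) hM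
  obtain ⟨c₂, hc₂, hWlow⟩ := le_errorEnergy (K := K) hM
  obtain ⟨c₃, hc₃, hAlow⟩ := le_paramEnergy hK
  obtain ⟨j, hj⟩ := hM.bounded_J
  have hW0 : ∀ t, T ≤ t → 0 ≤ W t := fun t ht =>
    le_trans (by positivity) (hWlow t (z t) (hΘ t ht))
  have hA0 : ∀ t, 0 ≤ A t := fun t => le_trans (by positivity) (hAlow (z t))
  have hWAC : ∀ t, T ≤ t → AbsolutelyContinuousOnInterval W T t := fun t ht =>
    ContDiffAt.comp_absolutelyContinuousOnInterval (c := fun t => (t, z t))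
      (f := fun y : ℝ × NodeState m p r => errorEnergy M K y.1 y.2)
      (fun u hu => contDiffAt_errorEnergy hM hK u
        (hΘ u (by rw [Set.uIcc_of_le ht] at hu; exact hu.1)))
      ((absolutelyContinuousOnInterval_id T t).prodMk (hz t ht))
  have hAAC : ∀ t, T ≤ t → AbsolutelyContinuousOnInterval A T t := fun t ht =>
    ContDiffAt.comp_absolutelyContinuousOnInterval (fun u _ => contDiff_paramEnergy.contDiffAt)
      (hz t ht)
  have hVAC : ∀ t, T ≤ t → AbsolutelyContinuousOnInterval (fun t => W t + A t) T t := fun t ht =>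
    (hWAC t ht).fun_add (hAAC t ht)
  have hdW : ∀ᵐ t : ℝ, T < t → HasDerivAt W
      (inner ℝ (s t) (regr M K t (z t) ((z t).est - M.ϑ)) + feedbackPower M K t (z t)) t := by
    filter_upwards [hd] with t h ht
    obtain ⟨w, hw, hwq, hwdq, hwe, hwx, hwv⟩ := h ht
    exact hasDerivAt_errorEnergy hM hK (hΘ t ht.le) hw hwq hwx hwv hwdq
  have hdV : ∀ᵐ t : ℝ, T < t → HasDerivAt (fun t => W t + A t) (feedbackPower M K t (z t)) t := by
    filter_upwards [hd, hdW] with t h hW ht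
    obtain ⟨w, hw, hwq, hwdq, hwe, hwx, hwv⟩ := h ht
    exact ((hW ht).add (hasDerivAt_paramEnergy hK hw hwe)).congr_deriv (by ring)
  have hVle : ∀ t, T ≤ t → W t + A t ≤ W T + A T := fun t ht => by
    have := AbsolutelyContinuousOnInterval.le_add_mul_of_ae_deriv_le (c := 0) hVAC (by
      filter_upwards [hdV] with t h ht
      refine ⟨_, (hfp t (hT.trans ht.le) (z t)).trans ?_, h ht⟩
      nlinarith [sq_nonneg ‖sHat M K t (z t)‖]) le_rfl ht
    simpa using this
  have hsb : ∀ t, T ≤ t → ‖s t‖ ≤ √((W T + A T) / c₂) := fun t ht => by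
    refine Real.le_sqrt_of_sq_le ((le_div_iff₀ hc₂).2 ?_)
    linarith [hWlow t (z t) (hΘ t ht), hVle t ht, hA0 t, mul_comm c₂ (‖s t‖ ^ 2)]
  have hϑb : ∀ t, T ≤ t → ‖(z t).est - M.ϑ‖ ≤ √((W T + A T) / c₃) := fun t ht => by
    refine Real.le_sqrt_of_sq_le ((le_div_iff₀ hc₃).2 ?_)
    linarith [hAlow (z t), hVle t ht, hW0 t ht, mul_comm c₃ (‖(z t).est - M.ϑ‖ ^ 2)]
  have heAC : ∀ t, T ≤ t → AbsolutelyContinuousOnInterval e T t := fun t ht =>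
    ContDiffAt.comp_absolutelyContinuousOnInterval
      (f := fun z : NodeState m p r => M.ψ z.1 - z.2.2.2.1)
      (fun u _ => (((hM.smooth_ψ.of_le (by norm_num)).comp
        (f := fun z : NodeState m p r => z.1) (by fun_prop)).sub
        (by fun_prop)).contDiffAt) (hz t ht)
  have hde : ∀ᵐ t : ℝ, T < t → HasDerivAt e (M.J (z t).q (s t) - K.α • e t) t := by
    filter_upwards [hd] with t h ht
    obtain ⟨w, hw, hwq, hwdq, hwe, hwx, hwv⟩ := h ht
    have h1 := ((NodeState.qL m p r).hasDerivAt_comp hw).congr_deriv hwq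
    have h2 := ((NodeState.xhL m p r).hasDerivAt_comp hw).congr_deriv hwx
    refine (((hM.hasFDerivAt_ψ (z t).1).comp_hasDerivAt t h1).sub h2).congr_deriv ?_
    rw [J_dq_eq (K := K) hM t (hΘ t ht.le)]
    simp only [hsdef, hedef]
    abel
  have hJsb : ∀ t, T ≤ t → ‖M.J (z t).q (s t)‖ ≤ j * ‖s t‖ := fun t ht =>
    ContinuousLinearMap.le_of_opNorm_le _ (hj _ (hΘ t ht)) _
  have hj0 : 0 ≤ j := (norm_nonneg _).trans (hj _ (hΘ T le_rfl))
  -- The bounds follow in order: energy bounds `ŝ` and the parameter error, `ŝ` bounds `e`, and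
  -- these bound the regressor and hence `W'`.
  obtain ⟨E, hE⟩ := exists_norm_le_of_ae_deriv_eq hK.α_pos
    (fun t ht => (hJsb t ht).trans (mul_le_mul_of_nonneg_left (hsb t ht) hj0)) heAC hde
  obtain ⟨c₄, hc₄⟩ := exists_bound_regr hM hK (max (√((W T + A T) / c₂)) (max E R))
  obtain ⟨c₅, hc₅⟩ := exists_bound_feedbackPower (K := K) hM (√((W T + A T) / c₂))
  have hWlim : Tendsto W atTop (𝓝 0) := by
    -- `W ≤ c₁‖ŝ‖²` converts the decay `-k‖ŝ‖²` into `-(k/c₁) W`. The argument runs on `W` because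
    -- its rate is known even where that of `ŝ` is not.
    refine tendsto_zero_of_dissipation (V := fun t => W t + A t) (c := k / c₁)
      (R := √((W T + A T) / c₂) * (c₄ * √((W T + A T) / c₃)) + c₅)
      (by positivity) hVAC (fun t ht => add_nonneg (hW0 t ht) (hA0 t)) ?_ hWAC hW0 ?_
    · filter_upwards [hdV] with t h ht
      refine ⟨_, (hfp t (hT.trans ht.le) (z t)).trans ?_, h ht⟩
      have h1 : k / c₁ * W t ≤ k / c₁ * (c₁ * ‖sHat M K t (z t)‖ ^ 2) := by
        gcongr
        exact hWup t (z t) (hΘ t ht.le)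
      have h2 : k / c₁ * (c₁ * ‖sHat M K t (z t)‖ ^ 2) = k * ‖sHat M K t (z t)‖ ^ 2 := by
        field_simp
      linarith
    · filter_upwards [hdW] with t h ht
      refine ⟨_, (abs_add_le _ _).trans (add_le_add ?_ ?_), h ht⟩
      · refine (abs_real_inner_le_norm _ _).trans ?_
        refine mul_le_mul (hsb t ht.le) ?_ (norm_nonneg _) (Real.sqrt_nonneg _)
        refine ContinuousLinearMap.le_of_opNorm_le_of_le _ ?_ (hϑb t ht.le)
        exact hc₄ t (hT.trans ht.le) _ (hΘ t ht.le) ((hsb t ht.le).trans (le_max_left _ _))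
          ((hE t ht.le).trans ((le_max_left _ _).trans (le_max_right _ _)))
          ((hvR t ht.le).trans ((le_max_right _ _).trans (le_max_right _ _)))
          ((haR t ht.le).trans ((le_max_right _ _).trans (le_max_right _ _)))
      · exact hc₅ t (hT.trans ht.le) _ (hΘ t ht.le) (hsb t ht.le)
  have hslim : Tendsto (fun t => ‖s t‖) atTop (𝓝 0) := by
    have h1 : Tendsto (fun t => √(W t / c₂)) atTop (𝓝 0) := by
      simpa using (hWlim.div_const c₂).sqrt
    refine squeeze_zero' (Eventually.of_forall fun t => norm_nonneg _) ?_ h1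
    filter_upwards [eventually_ge_atTop T] with t ht
    refine Real.le_sqrt_of_sq_le ((le_div_iff₀ hc₂).2 ?_)
    linarith [hWlow t (z t) (hΘ t ht), mul_comm c₂ (‖s t‖ ^ 2)]
  have hJs : Tendsto (fun t => M.J (z t).q (s t)) atTop (𝓝 0) := by
    refine squeeze_zero_norm' ?_ (by simpa using hslim.const_mul j)
    filter_upwards [eventually_ge_atTop T] with t ht using hJsb t ht
  have helim : Tendsto e atTop (𝓝 0) := tendsto_zero_of_ae_deriv_eq hK.α_pos hJs heAC hde
  refine ⟨helim, ?_, ?_⟩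
  · have : Tendsto (fun t => M.J (z t).q (s t) - K.α • e t) atTop (𝓝 0) := by
      simpa using hJs.sub (helim.const_smul K.α)
    refine this.congr' ?_
    filter_upwards [eventually_ge_atTop T] with t ht
    rw [J_dq_eq (K := K) hM t (hΘ t ht)]
    simp only [hsdef, hedef]
    abel
  · obtain ⟨b, hb0, hb⟩ := hM.bounded_nullProj
    refine squeeze_zero_norm' ?_ (by simpa using hslim.const_mul b)
    filter_upwards [eventually_ge_atTop T] with t ht
    rw [subtaskError_eq hM t (hΘ t ht)]
    exact ContinuousLinearMap.le_of_opNorm_le _ (hb _ (hΘ t ht)) _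

end Node

/-! ### The networked closed loop -/

theorem Interaction.continuous_disagreement {n m : ℕ} (G : Interaction n) (y₀ : Vec m)
    (i : Fin n) : Continuous fun y : Fin n → Vec m => G.disagreement y y₀ i := by
  simp only [Interaction.disagreement]
  fun_prop

theorem Interaction.continuousAt_signum_disagreement {X : Type*} [TopologicalSpace X] {n m : ℕ}
    (G : Interaction n) (β : ℝ) (y₀ : Vec m) {Y : X → Fin n → Vec m} {x : X}
    (hY : ContinuousAt Y x) {i : Fin n} {k : Fin m} (hD : G.disagreement (Y x) y₀ i k ≠ 0) :
    ContinuousAt (fun x => (-(β • sgn (G.disagreement (Y x) y₀ i)) : Vec m) k) x := by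
  have hc : ContinuousAt (fun x => G.disagreement (Y x) y₀ i k) x :=
    ((EuclideanSpace.proj (𝕜 := ℝ) k : Vec m →L[ℝ] ℝ).continuous.comp
      (G.continuous_disagreement y₀ i)).continuousAt.comp hY
  refine tendsto_nhds_of_eventually_eq ?_
  simp only [sgn, PiLp.neg_apply, PiLp.smul_apply, smul_eq_mul]
  rcases lt_or_gt_of_ne hD with h | h
  · filter_upwards [hc.eventually (gt_mem_nhds h)] with y hy
    rw [Real.sign_of_neg h, Real.sign_of_neg hy]
  · filter_upwards [hc.eventually (lt_mem_nhds h)] with y hy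
    rw [Real.sign_of_pos h, Real.sign_of_pos hy]

theorem EuclideanSpace.norm_le_of_forall_abs_le {k : ℕ} {v : Vec k} {c : ℝ}
    (h : ∀ j, |v j| ≤ c) : ‖v‖ ≤ k * c := by
  refine (EuclideanSpace.norm_le_sum_abs v).trans ?_
  exact (Finset.sum_le_card_nsmul _ _ c fun j _ => h j).trans (by simp)

section Network

variable {n m : ℕ} {p r : Fin n → ℕ} {M : (i : Fin n) → Manipulator m (p i) (r i)}
  {K : (i : Fin n) → Controller m (p i) (r i)} {L : Leader m} {G : ℝ → Interaction n}
  {β₁ β₂ β₃ t₀ : ℝ}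

/-- The layers `x̂`, `v̂`, `â` do not interact, so each is treated as a linear readout `P` of the
state. Off zero disagreement the readout of the field is locally constant in the relevant
coordinate, which determines its Filippov derivative. -/
theorem eventually_estimate_eq {Z : Type*} [NormedAddCommGroup Z] [NormedSpace ℝ Z]
    [MeasureSpace Z] {f : ℝ → Z → Z} {z : ℝ → Z} (hz : IsFilippovSolution f t₀ z)
    (hG : ∀ t, t₀ ≤ t → (G t).Valid) (hreach : ∀ t, t₀ ≤ t → (G t).LeaderReachable)
    (P : Fin n → Z →L[ℝ] Vec m) {y₀ dy₀ : ℝ → Vec m} {β : ℝ}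
    (hf : ∀ t x i, P i (f t x) = -(β • sgn ((G t).disagreement (fun j => P j x) (y₀ t) i)))
    (hy₀ : ∀ t, t₀ ≤ t → HasDerivWithinAt y₀ (dy₀ t) (Set.Ici t₀) t)
    (hbound : ∃ c < β, ∀ t, t₀ ≤ t → ∀ k, |dy₀ t k| ≤ c) :
    ∀ᶠ t in atTop, ∀ i, P i (z t) = y₀ t := by
  refine eventually_eq_of_signum_consensus (y := fun t i => P i (z t)) hG hreach
    (fun t ht => (ContinuousLinearMap.pi P).comp_absolutelyContinuousOnInterval (hz.1 t ht))
    hy₀ hbound ?_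
  filter_upwards [hz.2] with t h ht i
  obtain ⟨w, hw, hd⟩ := h ht
  refine ⟨P i w, (P i).hasDerivAt_comp hd, fun k hk => ?_⟩
  have hcont : ContinuousAt (fun x => ((EuclideanSpace.proj k : Vec m →L[ℝ] ℝ) ∘L P i) (f t x))
      (z t) := by
    have := (G t).continuousAt_signum_disagreement β (y₀ t) (Y := fun x j => P j x) (x := z t)
      (continuous_pi fun j => (P j).continuous).continuousAt hk
    simp only [ContinuousLinearMap.comp_apply, hf]
    exact this
  have h1 := map_eq_of_mem_filippov hw _ hcont
  simp only [ContinuousLinearMap.comp_apply, hf] at h1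
  simpa [sgn] using h1

/-- These are the linear functionals of the discontinuous field that remain continuous, and they are
all that the energy argument uses. -/
theorem closedLoop_filippov_apply (hM : ∀ i, (M i).Standing t₀)
    (hK : ∀ i, (K i).Admissible (M i) t₀) {t : ℝ} {x w : NetState m p r}
    (hw : w ∈ filippov (closedLoop M K L G β₁ β₂ β₃ t) x) (i : Fin n) (hq : (x i).q ∈ (M i).Θ) :
    (w i).q = (x i).dq ∧
      inner ℝ (sHat (M i) (K i) t (x i)) ((M i).H (x i).q (w i).dq) =
        inner ℝ (sHat (M i) (K i) t (x i)) ((M i).H (x i).q (jointAcc (M i) (K i) t (x i))) ∧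
      (w i).est = adaptRate (M i) (K i) t (x i) := by
  have hproj : ContinuousAt (fun y : NetState m p r => y i) x := (continuous_apply i).continuousAt
  refine ⟨?_, ?_, ?_⟩
  · exact map_eq_of_mem_filippov hw
      (NodeState.qL m (p i) (r i) ∘L ContinuousLinearMap.proj i)
      ((NodeState.dqL m (p i) (r i)).continuous.continuousAt.comp hproj)
  · exact map_eq_of_mem_filippov hw
      (innerSL ℝ (sHat (M i) (K i) t (x i)) ∘L (M i).H (x i).q ∘L
        NodeState.dqL m (p i) (r i) ∘L ContinuousLinearMap.proj i)
      (ContinuousAt.comp (f := fun y : NetState m p r => y i)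
        (continuousAt_inner_jointAcc (hM i) (hK i) t hq) hproj)
  · exact map_eq_of_mem_filippov hw
      (NodeState.estL m (p i) (r i) ∘L ContinuousLinearMap.proj i)
      (ContinuousAt.comp (f := fun y : NetState m p r => y i)
        (continuousAt_adaptRate (hM i) (hK i) t hq) hproj)

end Network

theorem corollary3 {n m : ℕ} (hm : 2 ≤ m) (p r : Fin n → ℕ) (hp : ∀ i, m ≤ p i)
    (t₀ : ℝ) (ht₀ : 0 ≤ t₀)
    (M : (i : Fin n) → Manipulator m (p i) (r i)) (hM : ∀ i, (M i).Standing t₀)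
    (K : (i : Fin n) → Controller m (p i) (r i)) (hK : ∀ i, (K i).Admissible (M i) t₀)
    (L : Leader m) (β₁ β₂ β₃ : ℝ) (hβ₁ : 0 < β₁) (hβ₂ : 0 < β₂) (hβ₃ : 0 < β₃)
    (hL : L.Bounded β₁ β₂ β₃ t₀)
    (G : ℝ → Interaction n) (hG : ∀ t, t₀ ≤ t → (G t).Valid)
    (hreach : ∀ t, t₀ ≤ t → (G t).LeaderReachable)
    (z : ℝ → NetState m p r)
    (hz : IsFilippovSolution (closedLoop M K L G β₁ β₂ β₃) t₀ z)
    (hΘ : ∀ t, t₀ ≤ t → ∀ i, (z t i).q ∈ (M i).Θ) :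
    (∀ i, Tendsto (fun t => (M i).ψ (z t i).q - L.x t) atTop (𝓝 0) ∧
      Tendsto (fun t => (M i).J (z t i).q (z t i).dq - L.v t) atTop (𝓝 0)) ∧
    ∀ i, m < p i → Tendsto (fun t => subtaskError (M i) (K i) t (z t i)) atTop (𝓝 0) := by
  have hx := eventually_estimate_eq hz hG hreach
    (fun i => NodeState.xhL m (p i) (r i) ∘L ContinuousLinearMap.proj i)
    (fun _ _ _ => rfl) hL.deriv_x hL.bound_v
  have hv := eventually_estimate_eq hz hG hreach
    (fun i => NodeState.vhL m (p i) (r i) ∘L ContinuousLinearMap.proj i)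
    (fun _ _ _ => rfl) hL.deriv_v hL.bound_a
  have ha := eventually_estimate_eq hz hG hreach
    (fun i => NodeState.ahL m (p i) (r i) ∘L ContinuousLinearMap.proj i)
    (fun _ _ _ => rfl) hL.deriv_a hL.bound_da
  obtain ⟨T, hT⟩ := eventually_atTop.1 ((hx.and (hv.and ha)).and (eventually_ge_atTop t₀))
  have hT₀ : t₀ ≤ T := (hT T le_rfl).2
  have hxT : ∀ t, T ≤ t → ∀ i, (z t i).xh = L.x t := fun t ht => (hT t ht).1.1
  have hvT : ∀ t, T ≤ t → ∀ i, (z t i).vh = L.v t := fun t ht => (hT t ht).1.2.1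
  have haT : ∀ t, T ≤ t → ∀ i, (z t i).ah = L.a t := fun t ht => (hT t ht).1.2.2
  obtain ⟨c₁, -, hc₁⟩ := hL.bound_v
  obtain ⟨c₂, -, hc₂⟩ := hL.bound_a
  have key : ∀ i, _ := fun i =>
    tendsto_of_consistent_estimates (hM i) (hK i) (z := fun t => z t i) (T := T)
    (R := max (m * c₁) (m * c₂)) hT₀
    (fun t ht => (ContinuousLinearMap.proj (R := ℝ) (φ := fun i => NodeState m (p i) (r i))
      i).comp_absolutelyContinuousOnInterval ((hz.1 t (hT₀.trans ht)).mono (by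
        rw [Set.uIcc_of_le ht, Set.uIcc_of_le (hT₀.trans ht)]
        exact Set.Icc_subset_Icc_left hT₀)))
    (fun t ht => hΘ t (hT₀.trans ht) i)
    (fun t ht => by
      rw [hvT t ht i]
      exact (EuclideanSpace.norm_le_of_forall_abs_le (hc₁ t (hT₀.trans ht))).trans
        (le_max_left _ _))
    (fun t ht => by
      rw [haT t ht i]
      exact (EuclideanSpace.norm_le_of_forall_abs_le (hc₂ t (hT₀.trans ht))).trans
        (le_max_right _ _))
    (by
      filter_upwards [hz.2] with t h ht
      obtain ⟨w, hw, hd⟩ := h (hT₀.trans_lt ht)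
      have ht' : t₀ < t := hT₀.trans_lt ht
      obtain ⟨h1, h2, h3⟩ := closedLoop_filippov_apply hM hK hw i (hΘ t ht'.le i)
      have hdi := hasDerivAt_pi.1 hd i
      refine ⟨w i, hdi, h1, h2, h3, ?_, ?_⟩
      -- On agreement the disagreement is zero and Filippov's set leaves this rate open. It is
      -- recovered from `x̂ = x₀` near `t`, which gives the rate `v₀ = v̂`.
      · refine ((NodeState.xhL m (p i) (r i)).hasDerivAt_comp hdi).unique ?_
        rw [hvT t ht.le i]
        refine ((hL.deriv_x t ht'.le).hasDerivAt (Ici_mem_nhds ht')).congr_of_eventuallyEq ?_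
        filter_upwards [lt_mem_nhds ht] with u hu using hxT u hu.le i
      · refine ((NodeState.vhL m (p i) (r i)).hasDerivAt_comp hdi).unique ?_
        rw [haT t ht.le i]
        refine ((hL.deriv_v t ht'.le).hasDerivAt (Ici_mem_nhds ht')).congr_of_eventuallyEq ?_
        filter_upwards [lt_mem_nhds ht] with u hu using hvT u hu.le i)
  refine ⟨fun i => ⟨(key i).1.congr' ?_, (key i).2.1.congr' ?_⟩, fun i _ => (key i).2.2⟩
  · filter_upwards [eventually_ge_atTop T] with t ht
    rw [hxT t ht i]
  · filter_upwards [eventually_ge_atTop T] with t ht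
    rw [hvT t ht i]
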